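/- Let $G$ be a second countable, locally compact, Hausdorff, étale groupoid with unit space $G^{(0)}$ and source map $s$, and let $\mathcal{D}$ be a set of open subgroupoids of $G$. Assume that $G$ decomposes over $\mathcal{D}$, i.e. for every open, relatively compact subset $K$ of $G$ there is an open cover $G^{(0)}=U_0\cup U_1$ such that for each $i\in\{0,1\}$ the subgroupoid of $G$ generated by $\{k\in K : s(k)\in U_i\}$ is contained in an element of $\mathcal{D}$. For an open subgroupoid $H$ of $G$, regard $C^*_r(H)$ as the $C^*$-subalgebra of $C^*_r(G)$ that is the closure of $C_c(H)\subseteq C_c(G)$, and put $$\mathcal{C}:=\{(C^*_r(H_1),C^*_r(H_2)) : H_1,H_2\in\mathcal{D}\}.$$ (1) $A:=C^*_r(G)$ admits an approximate ideal structure over $\mathcal{C}$: for every $\delta>0$ and every finite subset $\mathcal{F}$ of $A$ there are a positive contraction $h$ in the multiplier algebra of $A$ and a pair $(C,D)\in\mathcal{C}$ such that for all $a\in\mathcal{F}$: $\|ha-ah\|<\delta$; $d(ha,C)<\delta$ and $d((1-h)a,D)<\delta$; $d((1-h)ha,C\cap D)<\delta$ and $d((1-h)h^2a,C\cap D)<\delta$.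 (2) If moreover every groupoid in $\mathcal{D}$ is closed as well as open in $G$, then this approximate ideal structure is uniform: for every $\epsilon>0$ there is $\delta>0$ such that for all $(C,D)\in\mathcal{C}$ and every $C^*$-algebra $B$, if $c\in C\otimes B$ and $d\in D\otimes B$ satisfy $\|c-d\|<\delta$, then there is $x\in(C\cap D)\otimes B$ with $\|x-c\|<\epsilon$ and $\|x-d\|<\epsilon$. Here $\otimes$ is the spatial tensor product, and $C\otimes B$, $D\otimes B$, $(C\cap D)\otimes B$ are closed linear spans of elementary tensors in $A\otimes B$. Furthermore, for every $H\in\mathcal{D}$ there is then a conditional expectation (a positive, contractive, $C^*_r(H)$-bilinear projection) $E:C^*_r(G)\to C^*_r(H)$ that extends the restriction map $C_c(G)\to C_c(H)$. -/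

import Mathlib

open CategoryTheory TopologicalSpace
open scoped CompactlySupported TensorProduct ENNReal

universe u v w

section CStarAlgebras

/-! ### Approximate ideal structures -/

/-- `h` is a positive contraction in the C*-algebra `M`. -/
def IsPositiveContraction {M : Type*} [CStarAlgebra M] (h : M) : Prop :=
  (∃ k : M, h = star k * k) ∧ ‖h‖ ≤ 1

/-- The C*-algebra `A` admits an approximate ideal structure over the set `𝒞` of pairs of
C*-subalgebras. Here `DoubleCentralizer ℂ A` is the multiplier algebra of `A`; for a multiplier `m`,
`m.fst a` is the product `m a` and `m.snd a` is the product `a m`. -/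
def AdmitsApproximateIdealStructure (A : Type*) [NonUnitalCStarAlgebra A]
    (𝒞 : Set (NonUnitalStarSubalgebra ℂ A × NonUnitalStarSubalgebra ℂ A)) : Prop :=
  ∀ δ : ℝ, 0 < δ → ∀ F : Finset A, ∃ h : DoubleCentralizer ℂ A, IsPositiveContraction h ∧
    ∃ p ∈ 𝒞, ∀ a ∈ F,
      ‖h.fst a - h.snd a‖ < δ ∧
      Metric.infDist (h.fst a) (p.1 : Set A) < δ ∧
      Metric.infDist ((1 - h).fst a) (p.2 : Set A) < δ ∧
      Metric.infDist (((1 - h) * h).fst a) ((p.1 ⊓ p.2 : NonUnitalStarSubalgebra ℂ A) : Set A) < δ ∧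
      Metric.infDist (((1 - h) * h ^ 2).fst a)
        ((p.1 ⊓ p.2 : NonUnitalStarSubalgebra ℂ A) : Set A) < δ

variable {A : Type*} [NonUnitalCStarAlgebra A] {B : Type*} [NonUnitalCStarAlgebra B]
  {H : Type*} [NormedAddCommGroup H] [InnerProductSpace ℂ H] [CompleteSpace H]
  {K : Type*} [NormedAddCommGroup K] [InnerProductSpace ℂ K] [CompleteSpace K]

/-- The Hilbert space tensor product of `H` and `K`. -/
abbrev HilbertTensor (H K : Type*) [NormedAddCommGroup H] [InnerProductSpace ℂ H]
    [NormedAddCommGroup K] [InnerProductSpace ℂ K] : Type _ :=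
  UniformSpace.Completion (H ⊗[ℂ] K)

/-- The bounded operator `S ⊗ T` on the Hilbert space tensor product, determined by
`(S ⊗ T) (ξ ⊗ η) = S ξ ⊗ T η`. -/
noncomputable def opTensor (S : H →L[ℂ] H) (T : K →L[ℂ] K) :
    HilbertTensor H K →L[ℂ] HilbertTensor H K :=
  (TensorProduct.mapL S T).completion

/-- For a C*-algebra `A` faithfully represented by `π` on `H`, a C*-algebra `B` faithfully
represented by `ρ` on `K`, and a C*-subalgebra `C` of `A`, this is `C ⊗ B`, the closed linear span
of the elementary tensors `c ⊗ b` inside the spatial tensor product `A ⊗ B`, the latter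
(which is the case where `C` is all of `A`) being realised as usual on the Hilbert space tensor
product of `H` and `K`. -/
noncomputable def spatialTensor (π : A →⋆ₙₐ[ℂ] (H →L[ℂ] H)) (ρ : B →⋆ₙₐ[ℂ] (K →L[ℂ] K))
    (C : NonUnitalStarSubalgebra ℂ A) :
    Submodule ℂ (HilbertTensor H K →L[ℂ] HilbertTensor H K) :=
  (Submodule.span ℂ {T | ∃ a ∈ C, ∃ b : B, T = opTensor (π a) (ρ b)}).topologicalClosure

/-- The C*-algebra `A`, faithfully represented by `π` on a Hilbert space, admits a uniform
approximate ideal structure over `𝒞`: for every `ε > 0` there is one `δ > 0` that works for all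
pairs in `𝒞` and all C*-algebras `B`. The representations `π` and `ρ` serve only to write down the
spatial tensor product of `A` and `B`. -/
def AdmitsUniformApproximateIdealStructure (π : A →⋆ₙₐ[ℂ] (H →L[ℂ] H))
    (𝒞 : Set (NonUnitalStarSubalgebra ℂ A × NonUnitalStarSubalgebra ℂ A)) : Prop :=
  Function.Injective π ∧ AdmitsApproximateIdealStructure A 𝒞 ∧
  ∀ ε : ℝ, 0 < ε → ∃ δ : ℝ, 0 < δ ∧ ∀ p ∈ 𝒞,
    ∀ (B : Type w) [NonUnitalCStarAlgebra B]
      (K : Type w) [NormedAddCommGroup K] [InnerProductSpace ℂ K] [CompleteSpace K]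
      (ρ : B →⋆ₙₐ[ℂ] (K →L[ℂ] K)), Function.Injective ρ →
      ∀ c ∈ spatialTensor π ρ p.1, ∀ d ∈ spatialTensor π ρ p.2, ‖c - d‖ < δ →
        ∃ x ∈ spatialTensor π ρ (p.1 ⊓ p.2), ‖x - c‖ < ε ∧ ‖x - d‖ < ε

/-- `E` is a conditional expectation of the C*-algebra `A` onto its C*-subalgebra `C`: a positive
linear contraction of `A` onto `C` that fixes `C` and is `C`-bilinear. -/
structure IsConditionalExpectation (C : NonUnitalStarSubalgebra ℂ A) (E : A →L[ℂ] A) : Prop where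
  mem : ∀ a, E a ∈ C
  apply_of_mem : ∀ c ∈ C, E c = c
  norm_apply_le : ∀ a, ‖E a‖ ≤ ‖a‖
  positive : ∀ a, ∃ b, E (star a * a) = star b * b
  left : ∀ c ∈ C, ∀ a, E (c * a) = c * E a
  right : ∀ c ∈ C, ∀ a, E (a * c) = E a * c

end CStarAlgebras

section Groupoids

/-! ### Étale groupoids

A groupoid is a small category in which all morphisms are invertible. Its unit space is the type `X`
of objects, its elements are the terms of `Arrow X`, and for `g : Arrow X` the source and the range
of `g` are `g.left` and `g.right`. The product `g h` of groupoid elements with `s(g) = r(h)` is the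
composition `h.hom ≫ g.hom`. -/

/-- The groupoid product `g * h` of a pair with `s(g) = r(h)`. -/
def groupoidMul {X : Type u} [Groupoid.{v} X] (g h : Arrow X) (e : g.left = h.right) : Arrow X :=
  Arrow.mk (h.hom ≫ eqToHom e.symm ≫ g.hom)

/-- The inverse of a groupoid element. -/
def groupoidInv {X : Type u} [Groupoid.{v} X] (g : Arrow X) : Arrow X :=
  Arrow.mk (Groupoid.inv g.hom)

/-- A locally compact, Hausdorff, étale groupoid: a topological groupoid whose space of elements is
locally compact and Hausdorff, and whose source map is a local homeomorphism. (The range map, being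
the composite of inversion and the source map, is then a local homeomorphism as well, and the units
identify the space `X` with an open and closed subspace of the groupoid.) -/
class EtaleGroupoid (X : Type u) [Groupoid.{v} X] [TopologicalSpace X]
    [TopologicalSpace (Arrow X)] : Prop where
  t2 : T2Space (Arrow X)
  locallyCompact : LocallyCompactSpace (Arrow X)
  continuous_unit : Continuous fun x : X => Arrow.mk (𝟙 x)
  continuous_inv : Continuous fun g : Arrow X => groupoidInv g
  continuous_mul : Continuous fun p : {p : Arrow X × Arrow X // p.1.left = p.2.right} =>
    groupoidMul p.1.1 p.1.2 p.2
  continuous_range : Continuous fun g : Arrow X => g.right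
  source_isLocalHomeomorph : IsLocalHomeomorph fun g : Arrow X => g.left

variable {X : Type u} [Groupoid.{v} X]

/-- The set of elements of a subgroupoid. -/
def arrowSet (S : Subgroupoid X) : Set (Arrow X) := {g | g.hom ∈ S.arrows g.left g.right}

/-- The subgroupoid generated by a set of elements. -/
def generatedBy (s : Set (Arrow X)) : Subgroupoid X :=
  Subgroupoid.generated fun _ _ => {f | Arrow.mk f ∈ s}

/-- The open subgroupoid `S` is decomposable over the set `𝒟` of open subgroupoids: for every open,
relatively compact subset `K` of `S` there is an open cover of the unit space of `S` by two sets `U₀`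
and `U₁`, such that for each of them the elements of `K` with source in it generate a subgroupoid
that is contained in a member of `𝒟`. -/
def Decomposable [TopologicalSpace X] [TopologicalSpace (Arrow X)]
    (S : Subgroupoid X) (𝒟 : Set (Subgroupoid X)) : Prop :=
  ∀ K : Set (Arrow X), IsOpen K → (∃ L : Set (Arrow X), IsCompact L ∧ K ⊆ L ∧ L ⊆ arrowSet S) →
    ∃ U : Fin 2 → Set X, (∀ i, IsOpen (U i)) ∧ U 0 ∪ U 1 = S.objs ∧
      ∀ i, ∃ T ∈ 𝒟, generatedBy {g ∈ K | g.left ∈ U i} ≤ T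

/-! ### The reduced C*-algebra -/

/-- The Hilbert space `ℓ²(G)`, the direct sum of the Hilbert spaces `ℓ²(G_x)`, where `x` runs over
the units and `G_x` is the set of elements with source `x`. -/
abbrev groupoidL2 (X : Type u) [Groupoid.{v} X] : Type (max u v) :=
  lp (fun _ : Arrow X => ℂ) 2

/-- The matrix of left convolution by `a`: the entry at `(g, k)` is `a(g k⁻¹)` if `g` and `k` have
the same source, and zero otherwise. -/
noncomputable def convolutionKernel (a : Arrow X → ℂ) (g k : Arrow X) : ℂ :=
  open Classical in
  if e : g.left = k.left then a (groupoidMul g (groupoidInv k) e) else 0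

/-- A matrix with uniformly bounded entries and a uniform bound on the number of non-zero entries in
each row and column defines a bounded operator on `ℓ²`. -/
theorem exists_operator_of_kernel {ι : Type*} (κ : ι → ι → ℂ) (N : ℕ) (M : ℝ)
    (hM : ∀ i j, ‖κ i j‖ ≤ M) (hrow : ∀ i, {j | κ i j ≠ 0}.encard ≤ N)
    (hcol : ∀ j, {i | κ i j ≠ 0}.encard ≤ N) :
    ∃ T : lp (fun _ : ι => ℂ) 2 →L[ℂ] lp (fun _ : ι => ℂ) 2,
      ∀ ξ i, T ξ i = ∑' j, κ i j * ξ j := by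
  classical
  have hfin : ∀ i, {j | κ i j ≠ 0}.Finite := fun i =>
    Set.finite_of_encard_le_coe (hrow i)
  have hM0 : ∀ (_ : ι), 0 ≤ M := fun i => (norm_nonneg _).trans (hM i i)
  have hsum : ∀ (ξ : ι → ℂ) i, ∑' j, κ i j * ξ j = ∑ j ∈ (hfin i).toFinset, κ i j * ξ j := by
    intro ξ i
    apply tsum_eq_sum
    intro j hj
    have : κ i j = 0 := by simpa using hj
    simp [this]
  -- the row estimate
  have hest : ∀ (ξ : ι → ℂ) i, ‖∑' j, κ i j * ξ j‖ ^ 2 ≤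
      N * M ^ 2 * ∑ j ∈ (hfin i).toFinset, ‖ξ j‖ ^ 2 := by
    intro ξ i
    rw [hsum]
    have hcard : ((hfin i).toFinset.card : ℝ) ≤ N := by
      have h := hrow i
      rw [(hfin i).encard_eq_coe_toFinset_card] at h
      exact_mod_cast h
    calc ‖∑ j ∈ (hfin i).toFinset, κ i j * ξ j‖ ^ 2
        ≤ (∑ j ∈ (hfin i).toFinset, M * ‖ξ j‖) ^ 2 := by
          gcongr
          refine (norm_sum_le _ _).trans (Finset.sum_le_sum fun j _ => ?_)
          rw [norm_mul]
          exact mul_le_mul_of_nonneg_right (hM i j) (norm_nonneg _)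
      _ ≤ (hfin i).toFinset.card * ∑ j ∈ (hfin i).toFinset, (M * ‖ξ j‖) ^ 2 :=
          sq_sum_le_card_mul_sum_sq
      _ = (hfin i).toFinset.card * (M ^ 2 * ∑ j ∈ (hfin i).toFinset, ‖ξ j‖ ^ 2) := by
          simp only [mul_pow, ← Finset.mul_sum]
      _ ≤ N * (M ^ 2 * ∑ j ∈ (hfin i).toFinset, ‖ξ j‖ ^ 2) := by
          gcongr
      _ = _ := by ring
  -- the column estimate
  have hsumm : ∀ ξ : lp (fun _ : ι => ℂ) 2, Summable fun j => ‖ξ j‖ ^ 2 := by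
    intro ξ
    have := (lp.memℓp ξ).summable (by norm_num)
    simpa using this
  have hnorm : ∀ ξ : lp (fun _ : ι => ℂ) 2, ‖ξ‖ ^ 2 = ∑' j, ‖ξ j‖ ^ 2 := by
    intro ξ
    have := lp.norm_rpow_eq_tsum (p := 2) (by norm_num) ξ
    simpa using this
  have hfinset : ∀ (ξ : lp (fun _ : ι => ℂ) 2) (s : Finset ι),
      ∑ i ∈ s, ‖∑' j, κ i j * ξ j‖ ^ 2 ≤ (N * M) ^ 2 * ‖ξ‖ ^ 2 := by
    intro ξ s
    set t : Finset ι := s.biUnion fun i => (hfin i).toFinset with ht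
    have hswap : ∑ i ∈ s, ∑ j ∈ (hfin i).toFinset, ‖ξ j‖ ^ 2 ≤ N * ‖ξ‖ ^ 2 := by
      calc ∑ i ∈ s, ∑ j ∈ (hfin i).toFinset, ‖ξ j‖ ^ 2
          = ∑ i ∈ s, ∑ j ∈ t, if κ i j ≠ 0 then ‖ξ j‖ ^ 2 else 0 := by
            refine Finset.sum_congr rfl fun i hi => ?_
            rw [← Finset.sum_filter]
            refine Finset.sum_congr ?_ fun _ _ => rfl
            ext j
            simp only [Set.Finite.mem_toFinset, Set.mem_ofPred_eq, Finset.mem_filter, ht,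
              Finset.mem_biUnion]
            exact ⟨fun h => ⟨⟨i, hi, h⟩, h⟩, fun h => h.2⟩
        _ = ∑ j ∈ t, ∑ i ∈ s, if κ i j ≠ 0 then ‖ξ j‖ ^ 2 else 0 := Finset.sum_comm
        _ ≤ ∑ j ∈ t, N * ‖ξ j‖ ^ 2 := by
            refine Finset.sum_le_sum fun j _ => ?_
            rw [← Finset.sum_filter, Finset.sum_const, nsmul_eq_mul]
            gcongr
            have h : ((s.filter fun i => κ i j ≠ 0 : Finset ι) : Set ι).encard ≤ N := by
              refine le_trans (Set.encard_le_encard ?_) (hcol j)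
              intro i hi
              simpa using (Finset.mem_filter.mp hi).2
            rw [Set.encard_coe_eq_coe_finsetCard] at h
            exact_mod_cast h
        _ = N * ∑ j ∈ t, ‖ξ j‖ ^ 2 := by rw [Finset.mul_sum]
        _ ≤ N * ‖ξ‖ ^ 2 := by
            rw [hnorm]
            gcongr
            exact (hsumm ξ).sum_le_tsum _ fun _ _ => by positivity
    calc ∑ i ∈ s, ‖∑' j, κ i j * ξ j‖ ^ 2
        ≤ ∑ i ∈ s, N * M ^ 2 * ∑ j ∈ (hfin i).toFinset, ‖ξ j‖ ^ 2 :=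
          Finset.sum_le_sum fun i _ => hest ξ i
      _ = N * M ^ 2 * ∑ i ∈ s, ∑ j ∈ (hfin i).toFinset, ‖ξ j‖ ^ 2 := by rw [Finset.mul_sum]
      _ ≤ N * M ^ 2 * (N * ‖ξ‖ ^ 2) := by gcongr
      _ = _ := by ring
  have hmem : ∀ ξ : lp (fun _ : ι => ℂ) 2, Memℓp (fun i => ∑' j, κ i j * ξ j) 2 := by
    intro ξ
    apply memℓp_gen
    have : Summable fun i => ‖∑' j, κ i j * ξ j‖ ^ 2 :=
      summable_of_sum_le (fun _ => by positivity) (hfinset ξ)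
    simpa using this
  let L : lp (fun _ : ι => ℂ) 2 →ₗ[ℂ] lp (fun _ : ι => ℂ) 2 :=
    { toFun := fun ξ => ⟨fun i => ∑' j, κ i j * ξ j, hmem ξ⟩
      map_add' := by
        intro ξ η
        ext i
        change ∑' j, κ i j * (ξ + η) j = (∑' j, κ i j * ξ j) + ∑' j, κ i j * η j
        simp only [hsum, ← Finset.sum_add_distrib]
        exact Finset.sum_congr rfl fun j _ => by rw [lp.coeFn_add, Pi.add_apply, mul_add]
      map_smul' := by
        intro c ξ
        ext i
        simp only [lp.coeFn_smul, Pi.smul_apply, smul_eq_mul, RingHom.id_apply, hsum,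
          Finset.mul_sum]
        exact Finset.sum_congr rfl fun j _ => by ring }
  refine ⟨L.mkContinuous (|N * M|) fun ξ => ?_, fun ξ i => rfl⟩
  apply le_of_sq_le_sq _ (by positivity)
  rw [mul_pow, sq_abs, hnorm (L ξ)]
  exact Real.tsum_le_of_sum_le (fun _ => by positivity) (hfinset ξ)

theorem exists_fibre_bound {Y Z : Type*} [TopologicalSpace Y] [TopologicalSpace Z] {f : Y → Z}
    (hf : IsLocalHomeomorph f) {L : Set Y} (hL : IsCompact L) :
    ∃ N : ℕ, ∀ z, {y ∈ L | f y = z}.encard ≤ N := by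
  refine hL.induction_on (p := fun s : Set Y => ∃ N : ℕ, ∀ z, {y ∈ s | f y = z}.encard ≤ N)
    ⟨0, by simp⟩ ?_ ?_ ?_
  · rintro s t hst ⟨N, hN⟩
    exact ⟨N, fun z => le_trans (Set.encard_le_encard fun y hy => And.intro (hst hy.1) hy.2) (hN z)⟩
  · rintro s t ⟨N, hN⟩ ⟨M, hM⟩
    refine ⟨N + M, fun z => ?_⟩
    push_cast
    refine le_trans (Set.encard_le_encard ?_)
      ((Set.encard_union_le _ _).trans (add_le_add (hN z) (hM z)))
    rintro y ⟨hy | hy, rfl⟩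
    · exact Or.inl ⟨hy, rfl⟩
    · exact Or.inr ⟨hy, rfl⟩
  · intro y _
    obtain ⟨e, hy, rfl⟩ := hf y
    refine ⟨e.source, mem_nhdsWithin_of_mem_nhds (e.open_source.mem_nhds hy), 1, fun z => ?_⟩
    push_cast
    rw [Set.encard_le_one_iff]
    rintro a b ⟨ha, rfl⟩ ⟨hb, hab⟩
    exact e.injOn ha hb hab.symm

theorem groupoidMul_mul_inv_cancel {g k : Arrow X} (e : g.left = k.left) :
    groupoidMul (groupoidMul g (groupoidInv k) e) k rfl = g := by
  obtain ⟨x, y, g⟩ := g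
  obtain ⟨z, t, k⟩ := k
  obtain rfl : x = z := e
  change Arrow.mk ((show x ⟶ t from k) ≫ 𝟙 t ≫ Groupoid.inv (show x ⟶ t from k) ≫ 𝟙 x ≫
    (show x ⟶ y from g)) = Arrow.mk (show x ⟶ y from g)
  simp

theorem groupoidMul_inv_mul_cancel {g k : Arrow X} (e : g.left = k.left) :
    groupoidMul (groupoidInv (groupoidMul g (groupoidInv k) e)) g rfl = k := by
  obtain ⟨x, y, g⟩ := g
  obtain ⟨z, t, k⟩ := k
  obtain rfl : x = z := e
  change Arrow.mk ((show x ⟶ y from g) ≫ 𝟙 y ≫ Groupoid.inv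
    (Groupoid.inv (show x ⟶ t from k) ≫ 𝟙 x ≫ (show x ⟶ y from g))) = Arrow.mk (show x ⟶ t from k)
  simp

/-- Left convolution by a continuous, compactly supported function is a bounded operator. -/
theorem exists_leftConvolution [TopologicalSpace X] [TopologicalSpace (Arrow X)] [EtaleGroupoid X]
    (a : C_c(Arrow X, ℂ)) : ∃ T : groupoidL2 X →L[ℂ] groupoidL2 X,
      ∀ ξ g, T ξ g = ∑' k, convolutionKernel a g k * ξ k := by
  have hsrc := EtaleGroupoid.source_isLocalHomeomorph (X := X)
  have hL : IsCompact (tsupport a) := a.hasCompactSupport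
  obtain ⟨N, hN⟩ := exists_fibre_bound hsrc hL
  obtain ⟨N', hN'⟩ := exists_fibre_bound hsrc (hL.image EtaleGroupoid.continuous_inv)
  obtain ⟨M, hM⟩ : ∃ M : ℝ, ∀ g, ‖a g‖ ≤ M := by
    obtain ⟨M, hM⟩ := a.hasCompactSupport.exists_bound_of_continuous a.continuous
    exact ⟨M, hM⟩
  have hsupp : ∀ g k, convolutionKernel a g k ≠ 0 →
      ∃ e : g.left = k.left, groupoidMul g (groupoidInv k) e ∈ tsupport a := by
    intro g k h
    unfold convolutionKernel at h
    split_ifs at h with e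
    · exact ⟨e, subset_tsupport _ h⟩
    · exact absurd rfl h
  refine exists_operator_of_kernel (convolutionKernel a) (N + N') M (fun g k => ?_) (fun g => ?_)
    (fun k => ?_)
  · unfold convolutionKernel
    split_ifs with e
    · exact hM _
    · simpa using (norm_nonneg _).trans (hM g)
  · refine le_trans ?_ ((hN' g.right).trans (by exact_mod_cast Nat.le_add_left _ _))
    classical
    refine Set.encard_le_encard_of_injOn
      (f := fun k => if e : g.left = k.left then groupoidInv (groupoidMul g (groupoidInv k) e) else k)
      ?_ ?_
    · intro k hk
      obtain ⟨e, h⟩ := hsupp g k hk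
      simp only [dif_pos e]
      exact ⟨⟨_, h, rfl⟩, rfl⟩
    · intro k hk k' hk' h
      obtain ⟨e, -⟩ := hsupp g k hk
      obtain ⟨e', -⟩ := hsupp g k' hk'
      simp only [dif_pos e, dif_pos e'] at h
      rw [← groupoidMul_inv_mul_cancel e, ← groupoidMul_inv_mul_cancel e']
      congr 1
  · refine le_trans ?_ ((hN k.right).trans (by exact_mod_cast Nat.le_add_right _ _))
    classical
    refine Set.encard_le_encard_of_injOn
      (f := fun g => if e : g.left = k.left then groupoidMul g (groupoidInv k) e else g)
      ?_ ?_
    · intro g hg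
      obtain ⟨e, h⟩ := hsupp g k hg
      simp only [dif_pos e]
      exact ⟨h, rfl⟩
    · intro g hg g' hg' h
      obtain ⟨e, -⟩ := hsupp g k hg
      obtain ⟨e', -⟩ := hsupp g' k hg'
      simp only [dif_pos e, dif_pos e'] at h
      rw [← groupoidMul_mul_inv_cancel e, ← groupoidMul_mul_inv_cancel e']
      congr 1

variable [TopologicalSpace X] [TopologicalSpace (Arrow X)] [EtaleGroupoid X]

/-- The operator of left convolution by `a ∈ C_c(G)` on `ℓ²(G)`; it is the direct sum, over the
units `x`, of the regular representations of `a` on `ℓ²(G_x)`. -/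
noncomputable def leftConvolution (a : C_c(Arrow X, ℂ)) : groupoidL2 X →L[ℂ] groupoidL2 X :=
  (exists_leftConvolution a).choose

theorem leftConvolution_apply (a : C_c(Arrow X, ℂ)) (ξ : groupoidL2 X) (g : Arrow X) :
    leftConvolution a ξ g = ∑' k, convolutionKernel a g k * ξ k :=
  (exists_leftConvolution a).choose_spec ξ g

variable (X) in
/-- The reduced C*-algebra `C*_r(G)`: the C*-algebra generated by the left convolution operators,
which is the norm closure of `C_c(G)` with respect to the regular representations. -/
noncomputable def reducedCStarAlgebra : NonUnitalStarSubalgebra ℂ (groupoidL2 X →L[ℂ] groupoidL2 X) :=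
  (NonUnitalStarAlgebra.adjoin ℂ (Set.range (leftConvolution (X := X)))).topologicalClosure

noncomputable instance : NonUnitalCStarAlgebra (reducedCStarAlgebra X) :=
  NonUnitalStarSubalgebra.nonUnitalCStarAlgebra _
    (h_closed := NonUnitalStarSubalgebra.isClosed_topologicalClosure _)

/-- The element of `C*_r(G)` given by a function in `C_c(G)`. -/
noncomputable def toReduced (a : C_c(Arrow X, ℂ)) : reducedCStarAlgebra X :=
  ⟨leftConvolution a, NonUnitalStarSubalgebra.le_topologicalClosure _
    (NonUnitalStarAlgebra.subset_adjoin ℂ _ ⟨a, rfl⟩)⟩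

/-- The reduced C*-algebra `C*_r(S)` of an open subgroupoid `S`, as a C*-subalgebra of `C*_r(G)`:
the one generated by `C_c(S)`, which consists of the functions in `C_c(G)` supported in `S`. -/
noncomputable def subgroupoidAlgebra (S : Subgroupoid X) :
    NonUnitalStarSubalgebra ℂ (reducedCStarAlgebra X) :=
  (NonUnitalStarAlgebra.adjoin ℂ
    {T | ∃ a : C_c(Arrow X, ℂ), tsupport a ⊆ arrowSet S ∧ T = toReduced a}).topologicalClosure

/-- The pairs `(C*_r(S₁), C*_r(S₂))` with `S₁` and `S₂` in `𝒟`. -/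
def algebraPairs (𝒟 : Set (Subgroupoid X)) :
    Set (NonUnitalStarSubalgebra ℂ (reducedCStarAlgebra X) ×
      NonUnitalStarSubalgebra ℂ (reducedCStarAlgebra X)) :=
  {p | ∃ S₁ ∈ 𝒟, ∃ S₂ ∈ 𝒟, p = (subgroupoidAlgebra S₁, subgroupoidAlgebra S₂)}

end Groupoids

/-!
The algebra `C_c(G)` acts on `ℓ²(G)` by matrices whose entry at `(g, k)` depends on `g k⁻¹` only, and
everything below is read off from matrix entries.

*Density.* `C_c(G)` is closed under convolution (`exists_leftConvolution_eq_mul`) and adjoints, and so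
is `C_c(S)` for each open subgroupoid `S`. Hence the generated C*-algebras are just the closures of
these algebras, and it suffices to work with finitely many functions in `C_c(G)`, whose supports lie
in one compact set `K` closed under inversion.

*The approximate ideal structure.* Decompose a relatively compact set containing all products of at
most `N + 1` elements of a compact neighbourhood `L` of `K`. If `x = s(g)` is reached from `U 0` by a
product `q` of elements of `L`, then `g = (g q) q⁻¹`, so `g` lies in the subgroupoid generated by the
longer products with source in `U 0` (`mem_arrowSet_of_mem_expand`). So there is room for an
increasing sequence of `N + 1` Urysohn functions, each equal to `1` on the `K`-translate of the
support of the one before, all supported in sets where the elements of `K` still lie in one member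
`S₁` of `𝒟`. Their average `h` changes by at most `1 / (N + 1)` along `K` (`abs_average_sub_le`), and
`1 - h` is supported in `U 1`. As a multiplier, `h` sends `a` to a function supported in `S₁`, `1 - h`
sends `a` to one supported in `S₂`, and by the Schur test (`norm_le_of_entry`) the commutator of `h`
with `a` is small.

*The clopen case.* If `S` is clopen, the cosets `S k` cut `ℓ²(G)` into orthogonal blocks, and
compression to these blocks deletes the entries with `g k⁻¹ ∉ S`. On `C_c(G)` this is restriction to
`S`, so compression is the conditional expectation `E` onto `C*_r(S)`. Block compression makes sense
on the Hilbert space tensor product as well, where it is the contraction `E ⊗ id`. For nearby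
`c ∈ C*_r(S₁) ⊗ B` and `d ∈ C*_r(S₂) ⊗ B` the element `(E ⊗ id) d`, formed with the expectation onto
`C*_r(S₁)`, is as close to `c = (E ⊗ id) c` as `d` is, and it lies in the tensor product of the
intersection with `B`, because restricting a function supported in `S₂` to `S₁` gives a function
supported in `S₁ ∩ S₂`. So `δ = ε / 2` works for all pairs and all `B`.
-/

section MatrixEntries

/-! ### Matrix entries of operators on `ℓ²` -/

/-- The Hilbert space `ℓ²(ι)`. -/
abbrev EllTwo (ι : Type*) : Type _ := lp (fun _ : ι => ℂ) 2

open scoped Classical in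
/-- The matrix entry of a bounded operator on `ℓ²(ι)` at `(i, j)`: the `i`-th coordinate of the image
of the `j`-th basis vector. -/
noncomputable def entry {ι : Type*} (T : EllTwo ι →L[ℂ] EllTwo ι) (i j : ι) : ℂ :=
  T (lp.single 2 j 1) i

variable {ι : Type*}

theorem entry_injective {S T : EllTwo ι →L[ℂ] EllTwo ι} (h : ∀ i j, entry S i j = entry T i j) : S = T := by
  classical
  have hs : ∀ j, S (lp.single 2 j 1) = T (lp.single 2 j 1) := fun j => by
    ext i
    have := h i j
    simp only [entry] at this
    convert this
  ext1 ξ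
  have hξ := lp.hasSum_single (p := 2) (by norm_num) ξ
  have h1 := hξ.mapL S
  have h2 := hξ.mapL T
  refine h1.unique ?_
  convert h2 using 2 with j
  have : (lp.single 2 j (ξ j) : EllTwo ι) = ξ j • lp.single 2 j (1 : ℂ) := by
    rw [← lp.single_smul]; simp
  rw [this, map_smul, map_smul, hs]

theorem entry_add (S T : EllTwo ι →L[ℂ] EllTwo ι) (i j : ι) : entry (S + T) i j = entry S i j + entry T i j :=
  rfl

theorem entry_sub (S T : EllTwo ι →L[ℂ] EllTwo ι) (i j : ι) : entry (S - T) i j = entry S i j - entry T i j :=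
  rfl

theorem entry_smul (c : ℂ) (T : EllTwo ι →L[ℂ] EllTwo ι) (i j : ι) : entry (c • T) i j = c * entry T i j :=
  rfl

theorem entry_eq_of_apply {T : EllTwo ι →L[ℂ] EllTwo ι} {κ : ι → ι → ℂ}
    (hT : ∀ ξ i, T ξ i = ∑' j, κ i j * ξ j) (i j : ι) : entry T i j = κ i j := by
  classical
  rw [entry, hT, tsum_eq_single j]
  · convert mul_one _
    exact lp.single_apply_self _ _ _
  · intro k hk
    convert mul_zero _
    exact lp.single_apply_ne _ _ _ hk

/-- The `i`-th coordinate, as a bounded functional on `ℓ²(ι)`. -/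
noncomputable def coordinate (i : ι) : EllTwo ι →L[ℂ] ℂ :=
  LinearMap.mkContinuous
    { toFun := fun ξ => ξ i
      map_add' := fun _ _ => rfl
      map_smul' := fun _ _ => rfl } 1 fun ξ => by
        rw [one_mul]
        exact lp.norm_apply_le_norm (by norm_num) ξ i

theorem hasSum_entry_mul (T : EllTwo ι →L[ℂ] EllTwo ι) (ξ : EllTwo ι) (i : ι) :
    HasSum (fun j => entry T i j * ξ j) (T ξ i) := by
  classical
  have hξ := ((lp.hasSum_single (p := 2) (by norm_num) ξ).mapL T).mapL (coordinate i)
  change HasSum _ (T ξ i) at hξ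
  convert hξ using 2 with j
  have : (lp.single 2 j (ξ j) : EllTwo ι) = ξ j • lp.single 2 j (1 : ℂ) := by
    rw [← lp.single_smul]; simp
  rw [this, map_smul, map_smul, smul_eq_mul, mul_comm]
  congr 1

theorem hasSum_entry_mul_entry (S T : EllTwo ι →L[ℂ] EllTwo ι) (i k : ι) :
    HasSum (fun j => entry S i j * entry T j k) (entry (S * T) i k) :=
  hasSum_entry_mul S _ i

theorem entry_star (T : EllTwo ι →L[ℂ] EllTwo ι) (i j : ι) :
    entry (star T) i j = star (entry T j i) := by
  classical
  have h := ContinuousLinearMap.adjoint_inner_right T (lp.single 2 i (1 : ℂ) : EllTwo ι)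
    (lp.single 2 j (1 : ℂ))
  rw [lp.inner_single_left, lp.inner_single_right] at h
  simp only [RCLike.inner_apply, map_one, mul_one, one_mul] at h
  simp only [entry]
  rw [ContinuousLinearMap.star_eq_adjoint, RCLike.star_def]
  convert h

theorem lp_norm_sq_eq_tsum (ξ : EllTwo ι) : ‖ξ‖ ^ 2 = ∑' j, ‖ξ j‖ ^ 2 := by
  have := lp.norm_rpow_eq_tsum (p := 2) (by norm_num) ξ
  simpa using this

theorem lp_summable_norm_sq (ξ : EllTwo ι) : Summable fun j => ‖ξ j‖ ^ 2 := by
  have := (lp.memℓp ξ).summable (by norm_num)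
  simpa using this

/-- The Schur test: an operator whose entries are bounded by `M`, with at most `N` of them non-zero
in each row and column, has norm at most `N * M`. -/
theorem norm_le_of_entry (T : EllTwo ι →L[ℂ] EllTwo ι) (N : ℕ) (M : ℝ) (hM0 : 0 ≤ M)
    (hM : ∀ i j, ‖entry T i j‖ ≤ M) (hrow : ∀ i, {j | entry T i j ≠ 0}.encard ≤ N)
    (hcol : ∀ j, {i | entry T i j ≠ 0}.encard ≤ N) : ‖T‖ ≤ N * M := by
  classical
  have hfin : ∀ i, {j | entry T i j ≠ 0}.Finite := fun i => Set.finite_of_encard_le_coe (hrow i)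
  have hsum : ∀ (ξ : EllTwo ι) i, T ξ i = ∑ j ∈ (hfin i).toFinset, entry T i j * ξ j := by
    intro ξ i
    rw [← (hasSum_entry_mul T ξ i).tsum_eq]
    apply tsum_eq_sum
    intro j hj
    have : entry T i j = 0 := by simpa using hj
    simp [this]
  have hest : ∀ (ξ : EllTwo ι) i, ‖T ξ i‖ ^ 2 ≤
      N * M ^ 2 * ∑ j ∈ (hfin i).toFinset, ‖ξ j‖ ^ 2 := by
    intro ξ i
    rw [hsum]
    have hcard : ((hfin i).toFinset.card : ℝ) ≤ N := by
      have h := hrow i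
      rw [(hfin i).encard_eq_coe_toFinset_card] at h
      exact_mod_cast h
    calc ‖∑ j ∈ (hfin i).toFinset, entry T i j * ξ j‖ ^ 2
        ≤ (∑ j ∈ (hfin i).toFinset, M * ‖ξ j‖) ^ 2 := by
          gcongr
          refine (norm_sum_le _ _).trans (Finset.sum_le_sum fun j _ => ?_)
          rw [norm_mul]
          exact mul_le_mul_of_nonneg_right (hM i j) (norm_nonneg _)
      _ ≤ (hfin i).toFinset.card * ∑ j ∈ (hfin i).toFinset, (M * ‖ξ j‖) ^ 2 :=
          sq_sum_le_card_mul_sum_sq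
      _ = (hfin i).toFinset.card * (M ^ 2 * ∑ j ∈ (hfin i).toFinset, ‖ξ j‖ ^ 2) := by
          simp only [mul_pow, ← Finset.mul_sum]
      _ ≤ N * (M ^ 2 * ∑ j ∈ (hfin i).toFinset, ‖ξ j‖ ^ 2) := by gcongr
      _ = _ := by ring
  have hfinset : ∀ (ξ : EllTwo ι) (s : Finset ι), ∑ i ∈ s, ‖T ξ i‖ ^ 2 ≤ (N * M) ^ 2 * ‖ξ‖ ^ 2 := by
    intro ξ s
    set t : Finset ι := s.biUnion fun i => (hfin i).toFinset with ht
    have hswap : ∑ i ∈ s, ∑ j ∈ (hfin i).toFinset, ‖ξ j‖ ^ 2 ≤ N * ‖ξ‖ ^ 2 := by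
      calc ∑ i ∈ s, ∑ j ∈ (hfin i).toFinset, ‖ξ j‖ ^ 2
          = ∑ i ∈ s, ∑ j ∈ t, if entry T i j ≠ 0 then ‖ξ j‖ ^ 2 else 0 := by
            refine Finset.sum_congr rfl fun i hi => ?_
            rw [← Finset.sum_filter]
            refine Finset.sum_congr ?_ fun _ _ => rfl
            ext j
            simp only [Set.Finite.mem_toFinset, Set.mem_ofPred_eq, Finset.mem_filter, ht,
              Finset.mem_biUnion]
            exact ⟨fun h => ⟨⟨i, hi, h⟩, h⟩, fun h => h.2⟩
        _ = ∑ j ∈ t, ∑ i ∈ s, if entry T i j ≠ 0 then ‖ξ j‖ ^ 2 else 0 := Finset.sum_comm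
        _ ≤ ∑ j ∈ t, N * ‖ξ j‖ ^ 2 := by
            refine Finset.sum_le_sum fun j _ => ?_
            rw [← Finset.sum_filter, Finset.sum_const, nsmul_eq_mul]
            gcongr
            have h : ((s.filter fun i => entry T i j ≠ 0 : Finset ι) : Set ι).encard ≤ N := by
              refine le_trans (Set.encard_le_encard ?_) (hcol j)
              intro i hi
              simpa using (Finset.mem_filter.mp hi).2
            rw [Set.encard_coe_eq_coe_finsetCard] at h
            exact_mod_cast h
        _ = N * ∑ j ∈ t, ‖ξ j‖ ^ 2 := by rw [Finset.mul_sum]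
        _ ≤ N * ‖ξ‖ ^ 2 := by
            rw [lp_norm_sq_eq_tsum]
            gcongr
            exact (lp_summable_norm_sq ξ).sum_le_tsum _ fun _ _ => by positivity
    calc ∑ i ∈ s, ‖T ξ i‖ ^ 2
        ≤ ∑ i ∈ s, N * M ^ 2 * ∑ j ∈ (hfin i).toFinset, ‖ξ j‖ ^ 2 :=
          Finset.sum_le_sum fun i _ => hest ξ i
      _ = N * M ^ 2 * ∑ i ∈ s, ∑ j ∈ (hfin i).toFinset, ‖ξ j‖ ^ 2 := by rw [Finset.mul_sum]
      _ ≤ N * M ^ 2 * (N * ‖ξ‖ ^ 2) := by gcongr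
      _ = _ := by ring
  refine T.opNorm_le_bound (by positivity) fun ξ => ?_
  apply le_of_sq_le_sq _ (by positivity)
  rw [mul_pow, lp_norm_sq_eq_tsum (T ξ)]
  exact Real.tsum_le_of_sum_le (fun _ => by positivity) (hfinset ξ)

open scoped Classical in
theorem exists_diagonal_operator (f : ι → ℂ) (hf : ∀ i, ‖f i‖ ≤ 1) :
    ∃ T : EllTwo ι →L[ℂ] EllTwo ι, ∀ i j, entry T i j = if i = j then f i else 0 := by
  obtain ⟨T, hT⟩ := exists_operator_of_kernel (fun i j : ι => if i = j then f i else 0) 1 1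
    (fun i j => by split_ifs <;> simp [hf])
    (fun i => by
      refine (Set.encard_le_encard (t := {i}) fun j hj => ?_).trans (by simp)
      by_contra h
      exact hj (if_neg fun e => h e.symm))
    (fun j => by
      refine (Set.encard_le_encard (t := {j}) fun i hi => ?_).trans (by simp)
      by_contra h
      exact hi (if_neg fun e => h e))
  exact ⟨T, fun i j => entry_eq_of_apply hT i j⟩

open scoped Classical in
/-- The operator of multiplication by a function bounded by `1`; zero for other functions. -/
noncomputable def diagonal (f : ι → ℂ) : EllTwo ι →L[ℂ] EllTwo ι :=
  if hf : ∀ i, ‖f i‖ ≤ 1 then (exists_diagonal_operator f hf).choose else 0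

open scoped Classical in
theorem entry_diagonal {f : ι → ℂ} (hf : ∀ i, ‖f i‖ ≤ 1) (i j : ι) :
    entry (diagonal f) i j = if i = j then f i else 0 := by
  rw [diagonal, dif_pos hf]
  exact (exists_diagonal_operator f hf).choose_spec i j

theorem diagonal_apply {f : ι → ℂ} (hf : ∀ i, ‖f i‖ ≤ 1) (ξ : EllTwo ι) (i : ι) :
    diagonal f ξ i = f i * ξ i := by
  refine (hasSum_entry_mul (diagonal f) ξ i).unique ?_
  convert hasSum_single i fun j hj => ?_ using 1
  · rw [entry_diagonal hf, if_pos rfl]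
  · rw [entry_diagonal hf, if_neg (Ne.symm hj), zero_mul]

theorem norm_diagonal_le (f : ι → ℂ) : ‖diagonal f‖ ≤ 1 := by
  by_cases hf : ∀ i, ‖f i‖ ≤ 1
  · have h := norm_le_of_entry (diagonal f) 1 1 zero_le_one
      (fun i j => by rw [entry_diagonal hf]; split_ifs <;> simp [hf])
      (fun i => by
        refine (Set.encard_le_encard (t := {i}) fun j hj => ?_).trans (by simp)
        by_contra h
        exact hj (by rw [entry_diagonal hf, if_neg fun e => h e.symm]))
      (fun j => by
        refine (Set.encard_le_encard (t := {j}) fun i hi => ?_).trans (by simp)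
        by_contra h
        exact hi (by rw [entry_diagonal hf, if_neg fun e : i = j => h e]))
    simpa using h
  · rw [diagonal, dif_neg hf]
    simp

theorem entry_diagonal_mul {f : ι → ℂ} (hf : ∀ i, ‖f i‖ ≤ 1) (T : EllTwo ι →L[ℂ] EllTwo ι) (i j : ι) :
    entry (diagonal f * T) i j = f i * entry T i j :=
  diagonal_apply hf _ i

theorem entry_mul_diagonal {f : ι → ℂ} (hf : ∀ i, ‖f i‖ ≤ 1) (T : EllTwo ι →L[ℂ] EllTwo ι) (i j : ι) :
    entry (T * diagonal f) i j = entry T i j * f j := by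
  refine (hasSum_entry_mul_entry T (diagonal f) i j).unique ?_
  convert hasSum_single j fun k hk => ?_ using 1
  · rw [entry_diagonal hf, if_pos rfl]
  · rw [entry_diagonal hf, if_neg hk, mul_zero]

theorem star_diagonal {f : ι → ℂ} (hf : ∀ i, ‖f i‖ ≤ 1) (hr : ∀ i, star (f i) = f i) :
    star (diagonal f) = diagonal f := by
  refine entry_injective fun i j => ?_
  rw [entry_star, entry_diagonal hf, entry_diagonal hf]
  by_cases h : i = j
  · subst h; simpa using hr i
  · rw [if_neg h, if_neg (Ne.symm h), star_zero]

end MatrixEntries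

section BlockCompression

/-! ### Compression to the blocks of an orthogonal family of projections -/

/-- A family of mutually orthogonal projections. -/
structure IsOrthogonalProjectionFamily {ι H : Type*} [NormedAddCommGroup H] [InnerProductSpace ℂ H]
    (P : ι → H →L[ℂ] H) : Prop where
  symm : ∀ i x y, inner ℂ (P i x) y = inner ℂ x (P i y)
  idem : ∀ i x, P i (P i x) = P i x
  orthogonal : ∀ i j, i ≠ j → ∀ x, P i (P j x) = 0

variable {ι H K : Type*} [NormedAddCommGroup H] [InnerProductSpace ℂ H]
  [NormedAddCommGroup K] [InnerProductSpace ℂ K]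

namespace IsOrthogonalProjectionFamily

theorem inner_eq_zero {P : ι → H →L[ℂ] H} (hP : IsOrthogonalProjectionFamily P) {i j : ι}
    (h : i ≠ j) (x y : H) : inner ℂ (P i x) (P j y) = 0 := by
  rw [hP.symm, hP.orthogonal i j h, inner_zero_right]

/-- Pythagoras' theorem. -/
theorem norm_sum_sq {P : ι → H →L[ℂ] H} (hP : IsOrthogonalProjectionFamily P) (x : ι → H)
    (s : Finset ι) : ‖∑ i ∈ s, P i (x i)‖ ^ 2 = ∑ i ∈ s, ‖P i (x i)‖ ^ 2 := by
  classical
  have h : ((‖∑ i ∈ s, P i (x i)‖ : ℝ) : ℂ) ^ 2 = ∑ i ∈ s, ((‖P i (x i)‖ : ℝ) : ℂ) ^ 2 := by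
    have hself : ∀ y : H, ((‖y‖ : ℝ) : ℂ) ^ 2 = inner ℂ y y :=
      fun y => (inner_self_eq_norm_sq_to_K (𝕜 := ℂ) y).symm
    simp only [hself, sum_inner, inner_sum]
    refine Finset.sum_congr rfl fun i hi => ?_
    exact Finset.sum_eq_single_of_mem i hi fun j _ hj => hP.inner_eq_zero hj _ _
  exact_mod_cast h

/-- Bessel's inequality. -/
theorem sum_norm_sq_le {P : ι → H →L[ℂ] H} (hP : IsOrthogonalProjectionFamily P) (x : H)
    (s : Finset ι) : ∑ i ∈ s, ‖P i x‖ ^ 2 ≤ ‖x‖ ^ 2 := by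
  have h1 := hP.norm_sum_sq (fun _ => x) s
  have h2 : ∑ i ∈ s, ‖P i x‖ ^ 2 ≤ ‖∑ i ∈ s, P i x‖ * ‖x‖ := by
    have h3 : ((∑ i ∈ s, ‖P i x‖ ^ 2 : ℝ) : ℂ) = inner ℂ (∑ i ∈ s, P i x) x := by
      rw [sum_inner]
      push_cast
      refine Finset.sum_congr rfl fun i _ => ?_
      rw [← hP.idem i x, hP.symm i (P i x) x, hP.idem]
      exact (inner_self_eq_norm_sq_to_K (𝕜 := ℂ) (P i x)).symm
    calc ∑ i ∈ s, ‖P i x‖ ^ 2 = ‖((∑ i ∈ s, ‖P i x‖ ^ 2 : ℝ) : ℂ)‖ := by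
          rw [Complex.norm_real, Real.norm_of_nonneg (by positivity)]
      _ ≤ _ := by rw [h3]; exact norm_inner_le_norm _ _
  rw [← h1] at h2 ⊢
  have h4 : ‖∑ i ∈ s, P i x‖ ≤ ‖x‖ := by
    by_contra! h
    nlinarith [norm_nonneg x]
  gcongr

theorem norm_sum_compression_le {P : ι → H →L[ℂ] H} (hP : IsOrthogonalProjectionFamily P)
    (T : H →L[ℂ] H) (x : H) (s : Finset ι) :
    ‖∑ i ∈ s, P i (T (P i x))‖ ^ 2 ≤ ‖T‖ ^ 2 * ∑ i ∈ s, ‖P i x‖ ^ 2 := by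
  rw [hP.norm_sum_sq, Finset.mul_sum]
  refine Finset.sum_le_sum fun i _ => ?_
  rw [← mul_pow]
  have h : ‖P i (T (P i x))‖ ≤ ‖T (P i x)‖ := by
    have := hP.sum_norm_sq_le (T (P i x)) {i}
    rw [Finset.sum_singleton] at this
    exact le_of_sq_le_sq this (norm_nonneg _)
  gcongr
  exact h.trans (T.le_opNorm _)

variable [CompleteSpace H]

theorem summable_compression {P : ι → H →L[ℂ] H} (hP : IsOrthogonalProjectionFamily P)
    (T : H →L[ℂ] H) (x : H) : Summable fun i => P i (T (P i x)) := by
  have hs : Summable fun i => ‖P i x‖ ^ 2 :=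
    summable_of_sum_le (fun _ => by positivity) (hP.sum_norm_sq_le x)
  rw [summable_iff_vanishing_norm] at hs ⊢
  intro ε hε
  obtain ⟨s, hs⟩ := hs ((ε / (‖T‖ + 1)) ^ 2) (by positivity)
  refine ⟨s, fun t ht => ?_⟩
  have h1 := hs t ht
  rw [Real.norm_of_nonneg (by positivity)] at h1
  refine lt_of_pow_lt_pow_left₀ 2 hε.le ((hP.norm_sum_compression_le T x t).trans_lt ?_)
  calc ‖T‖ ^ 2 * ∑ i ∈ t, ‖P i x‖ ^ 2 ≤ (‖T‖ + 1) ^ 2 * ∑ i ∈ t, ‖P i x‖ ^ 2 := by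
        gcongr; linarith
    _ < (‖T‖ + 1) ^ 2 * (ε / (‖T‖ + 1)) ^ 2 := by gcongr
    _ = ε ^ 2 := by field_simp

/-- The map `T ↦ ∑ i, P i T P i` on bounded operators, for a family `P` of mutually orthogonal
projections; the sum converges strongly. -/
noncomputable def compression {P : ι → H →L[ℂ] H} (hP : IsOrthogonalProjectionFamily P) :
    (H →L[ℂ] H) →L[ℂ] (H →L[ℂ] H) :=
  LinearMap.mkContinuous₂
    (LinearMap.mk₂ ℂ (fun (T : H →L[ℂ] H) x => ∑' i, P i (T (P i x)))
      (fun S T x => by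
        rw [← (hP.summable_compression S x).tsum_add (hP.summable_compression T x)]
        simp)
      (fun c T x => by rw [← (hP.summable_compression T x).tsum_const_smul]; simp)
      (fun T x y => by
        rw [← (hP.summable_compression T x).tsum_add (hP.summable_compression T y)]
        simp)
      (fun c T x => by rw [← (hP.summable_compression T x).tsum_const_smul]; simp))
    1 fun T x => by
      rw [LinearMap.mk₂_apply, one_mul]
      refine le_of_tendsto (hP.summable_compression T x).hasSum.norm (.of_forall fun s => ?_)
      refine le_of_sq_le_sq ((hP.norm_sum_compression_le T x s).trans ?_) (by positivity)
      rw [mul_pow]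
      gcongr
      exact hP.sum_norm_sq_le x s

theorem hasSum_compression {P : ι → H →L[ℂ] H} (hP : IsOrthogonalProjectionFamily P)
    (T : H →L[ℂ] H) (x : H) : HasSum (fun i => P i (T (P i x))) (hP.compression T x) :=
  (hP.summable_compression T x).hasSum

theorem norm_compression_le {P : ι → H →L[ℂ] H} (hP : IsOrthogonalProjectionFamily P)
    (T : H →L[ℂ] H) : ‖hP.compression T‖ ≤ ‖T‖ := by
  have h : ‖hP.compression‖ ≤ 1 := LinearMap.mkContinuous₂_norm_le _ zero_le_one _
  simpa using hP.compression.le_of_opNorm_le h T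

theorem compression_mul_left {P : ι → H →L[ℂ] H} (hP : IsOrthogonalProjectionFamily P)
    {S : H →L[ℂ] H} (hS : ∀ i, P i * S = S * P i) (T : H →L[ℂ] H) :
    hP.compression (S * T) = S * hP.compression T := by
  ext1 x
  refine (hP.hasSum_compression (S * T) x).unique ?_
  rw [mul_apply_eq_comp]
  convert (hP.hasSum_compression T x).mapL S using 2 with i
  exact congr($(hS i) (T (P i x)))

theorem compression_mul_right {P : ι → H →L[ℂ] H} (hP : IsOrthogonalProjectionFamily P)
    {S : H →L[ℂ] H} (hS : ∀ i, P i * S = S * P i) (T : H →L[ℂ] H) :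
    hP.compression (T * S) = hP.compression T * S := by
  ext1 x
  refine (hP.hasSum_compression (T * S) x).unique ?_
  rw [mul_apply_eq_comp]
  convert hP.hasSum_compression T (S x) using 2 with i
  exact congr(P i (T $((congr($(hS i) x)).symm)))

theorem isPositive_compression_star_mul_self {P : ι → H →L[ℂ] H}
    (hP : IsOrthogonalProjectionFamily P) (T : H →L[ℂ] H) :
    (hP.compression (star T * T)).IsPositive := by
  have hsum : ∀ x y, HasSum (fun i => inner ℂ (T (P i y)) (T (P i x)))
      (inner ℂ y (hP.compression (star T * T) x)) := fun x y => by
    refine ((hP.hasSum_compression (star T * T) x).mapL (innerSL ℂ y)).congr_fun fun i => ?_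
    rw [innerSL_apply_apply, ← hP.symm, mul_apply_eq_comp,
      ContinuousLinearMap.star_eq_adjoint, ContinuousLinearMap.adjoint_inner_right]
  rw [ContinuousLinearMap.isPositive_iff_complex]
  intro x
  have h1 : inner ℂ x (hP.compression (star T * T) x) =
      ((∑' i, ‖T (P i x)‖ ^ 2 : ℝ) : ℂ) := by
    rw [← (hsum x x).tsum_eq, Complex.ofReal_tsum]
    exact tsum_congr fun i => by
      rw [inner_self_eq_norm_sq_to_K]; simp
  rw [← inner_conj_symm, h1]
  simp [tsum_nonneg]

end IsOrthogonalProjectionFamily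

theorem opTensor_tmul (S : H →L[ℂ] H) (T : K →L[ℂ] K) (x : H) (y : K) :
    opTensor S T ((x ⊗ₜ[ℂ] y : H ⊗[ℂ] K) : HilbertTensor H K) = ((S x ⊗ₜ[ℂ] T y : H ⊗[ℂ] K) :) :=
  ContinuousLinearMap.completion_apply_coe _ _

theorem HilbertTensor.ext_tmul {S T : HilbertTensor H K →L[ℂ] HilbertTensor H K}
    (h : ∀ (x : H) (y : K), S ((x ⊗ₜ[ℂ] y : H ⊗[ℂ] K) : HilbertTensor H K) =
      T ((x ⊗ₜ[ℂ] y : H ⊗[ℂ] K) : HilbertTensor H K)) : S = T := by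
  ext1 z
  induction z using UniformSpace.Completion.induction_on with
  | hp => exact isClosed_eq S.continuous T.continuous
  | ih z =>
    induction z using TensorProduct.induction_on with
    | zero => rw [UniformSpace.Completion.coe_zero, map_zero, map_zero]
    | tmul x y => exact h x y
    | add a b ha hb => rw [UniformSpace.Completion.coe_add, map_add, map_add, ha, hb]

theorem inner_opTensor_one {P : H →L[ℂ] H} (hP : ∀ x y, inner ℂ (P x) y = inner ℂ x (P y))
    (x y : HilbertTensor H K) :
    inner ℂ (opTensor P (1 : K →L[ℂ] K) x) y = inner ℂ x (opTensor P (1 : K →L[ℂ] K) y) := by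
  induction x, y using UniformSpace.Completion.induction_on₂ with
  | hp => exact isClosed_eq (by fun_prop) (by fun_prop)
  | ih x y =>
    rw [opTensor, ContinuousLinearMap.completion_apply_coe,
      ContinuousLinearMap.completion_apply_coe, UniformSpace.Completion.inner_coe,
      UniformSpace.Completion.inner_coe]
    induction x using TensorProduct.induction_on with
    | zero => simp
    | add a b ha hb => simp only [map_add, inner_add_left, ha, hb]
    | tmul a a' =>
      induction y using TensorProduct.induction_on with
      | zero => simp
      | add a b ha hb => simp only [map_add, inner_add_right, ha, hb]
      | tmul b b' => simp [hP]

/-- The projections `P i ⊗ 1` on the Hilbert space tensor product. -/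
theorem IsOrthogonalProjectionFamily.opTensor_one {P : ι → H →L[ℂ] H}
    (hP : IsOrthogonalProjectionFamily P) :
    IsOrthogonalProjectionFamily fun i => opTensor (P i) (1 : K →L[ℂ] K) where
  symm i := inner_opTensor_one (hP.symm i)
  idem i x := by
    refine congr($(HilbertTensor.ext_tmul (S := opTensor (P i) (1 : K →L[ℂ] K) *
      opTensor (P i) (1 : K →L[ℂ] K)) (T := opTensor (P i) (1 : K →L[ℂ] K)) fun a b => ?_) x)
    simp [opTensor_tmul, hP.idem]
  orthogonal i j h x := by
    refine congr($(HilbertTensor.ext_tmul (S := opTensor (P i) (1 : K →L[ℂ] K) *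
      opTensor (P j) (1 : K →L[ℂ] K)) (T := 0) fun a b => ?_) x)
    simp [opTensor_tmul, hP.orthogonal i j h]

/-- Block compression is compatible with tensoring by a fixed operator. -/
theorem IsOrthogonalProjectionFamily.compression_opTensor [CompleteSpace H] {P : ι → H →L[ℂ] H}
    (hP : IsOrthogonalProjectionFamily P) (S : H →L[ℂ] H) (T : K →L[ℂ] K) :
    (hP.opTensor_one (K := K)).compression (opTensor S T) = opTensor (hP.compression S) T := by
  refine HilbertTensor.ext_tmul fun x y => ?_
  refine ((hP.opTensor_one (K := K)).hasSum_compression (opTensor S T) _).unique ?_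
  -- `F` is `z ↦ z ⊗ T y`, through which the strongly convergent sum is pushed
  have hlin : ∃ F : H →L[ℂ] HilbertTensor H K, ∀ z,
      F z = ((z ⊗ₜ[ℂ] T y : H ⊗[ℂ] K) : HilbertTensor H K) :=
    ⟨UniformSpace.Completion.toComplL.comp
      (LinearMap.mkContinuous ((TensorProduct.mk ℂ H K).flip (T y)) ‖T y‖ fun z => by
        simp [mul_comm]), fun z => rfl⟩
  obtain ⟨F, hF⟩ := hlin
  simp only [opTensor_tmul, one_apply_eq_self]
  simp only [← hF]
  exact (hP.hasSum_compression S x).mapL F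

end BlockCompression

section GroupoidAlgebra

/-! ### Products and inverses in a groupoid -/

variable {X : Type u} [Groupoid.{v} X]

theorem groupoidInv_groupoidInv (g : Arrow X) : groupoidInv (groupoidInv g) = g := by
  obtain ⟨x, y, g⟩ := g
  change Arrow.mk (Groupoid.inv (Groupoid.inv (show x ⟶ y from g))) = Arrow.mk (show x ⟶ y from g)
  simp

theorem groupoidMul_assoc {g h k : Arrow X} (e : g.left = h.right) (e' : h.left = k.right) :
    groupoidMul (groupoidMul g h e) k e' = groupoidMul g (groupoidMul h k e') e := by
  obtain ⟨x, y, g⟩ := g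
  obtain ⟨z, t, h⟩ := h
  obtain ⟨p, q, k⟩ := k
  obtain rfl : x = t := e
  obtain rfl : z = q := e'
  change Arrow.mk ((show p ⟶ z from k) ≫ 𝟙 z ≫ (show z ⟶ x from h) ≫ 𝟙 x ≫ (show x ⟶ y from g)) =
    Arrow.mk (((show p ⟶ z from k) ≫ 𝟙 z ≫ (show z ⟶ x from h)) ≫ 𝟙 x ≫ (show x ⟶ y from g))
  simp

theorem groupoidInv_groupoidMul {g h : Arrow X} (e : g.left = h.right) :
    groupoidInv (groupoidMul g h e) = groupoidMul (groupoidInv h) (groupoidInv g) e.symm := by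
  obtain ⟨x, y, g⟩ := g
  obtain ⟨z, t, h⟩ := h
  obtain rfl : x = t := e
  change Arrow.mk (Groupoid.inv ((show z ⟶ x from h) ≫ 𝟙 x ≫ (show x ⟶ y from g))) =
    Arrow.mk (Groupoid.inv (show x ⟶ y from g) ≫ 𝟙 x ≫ Groupoid.inv (show z ⟶ x from h))
  simp

theorem groupoidMul_mul_inv_cancel_right {g k : Arrow X} (e : g.left = k.right) :
    groupoidMul (groupoidMul g k e) (groupoidInv k) rfl = g := by
  obtain ⟨x, y, g⟩ := g
  obtain ⟨z, t, k⟩ := k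
  obtain rfl : x = t := e
  change Arrow.mk (Groupoid.inv (show z ⟶ x from k) ≫ 𝟙 z ≫ (show z ⟶ x from k) ≫ 𝟙 x ≫
    (show x ⟶ y from g)) = Arrow.mk (show x ⟶ y from g)
  simp

/-- `(g j⁻¹)(j k⁻¹) = g k⁻¹`. -/
theorem groupoidMul_div_div {g j k : Arrow X} (e : g.left = j.left) (e' : j.left = k.left) :
    groupoidMul (groupoidMul g (groupoidInv j) e) (groupoidMul j (groupoidInv k) e') rfl =
      groupoidMul g (groupoidInv k) (e.trans e') := by
  refine (groupoidMul_assoc rfl e').symm.trans ?_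
  congr 1
  exact groupoidMul_mul_inv_cancel e

/-- `g (h k)⁻¹ = (g k⁻¹) h⁻¹`. -/
theorem groupoidMul_inv_groupoidMul {g h k : Arrow X} (e : h.left = k.right)
    (e' : g.left = k.left) :
    groupoidMul g (groupoidInv (groupoidMul h k e)) e' =
      groupoidMul (groupoidMul g (groupoidInv k) e') (groupoidInv h) e.symm := by
  rw [groupoidMul_assoc e' e.symm]
  congr 1
  exact groupoidInv_groupoidMul e

theorem groupoidMul_mem_arrowSet {S : Subgroupoid X} {g h : Arrow X} (hg : g ∈ arrowSet S)
    (hh : h ∈ arrowSet S) (e : g.left = h.right) : groupoidMul g h e ∈ arrowSet S := by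
  obtain ⟨x, y, g⟩ := g
  obtain ⟨z, t, h⟩ := h
  obtain rfl : x = t := e
  change (show z ⟶ x from h) ≫ 𝟙 x ≫ (show x ⟶ y from g) ∈ S.arrows z y
  rw [Category.id_comp]
  exact S.mul hh hg

theorem groupoidInv_mem_arrowSet {S : Subgroupoid X} {g : Arrow X} (hg : g ∈ arrowSet S) :
    groupoidInv g ∈ arrowSet S :=
  S.inv hg

theorem arrowSet_mono {S T : Subgroupoid X} (h : S ≤ T) : arrowSet S ⊆ arrowSet T :=
  fun _ hg => (Subgroupoid.le_iff S T).1 h hg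

theorem subset_arrowSet_generatedBy (s : Set (Arrow X)) : s ⊆ arrowSet (generatedBy s) :=
  fun _ hg => Subgroupoid.subset_generated _ _ _ hg

theorem arrowSet_top : arrowSet (⊤ : Subgroupoid X) = Set.univ :=
  Set.eq_univ_of_forall fun _ => trivial

/-- The set of products of an element of `s` with an element of `t`. -/
def arrowMul (s t : Set (Arrow X)) : Set (Arrow X) :=
  {m | ∃ g ∈ s, ∃ h ∈ t, ∃ e : g.left = h.right, m = groupoidMul g h e}

theorem arrowMul_mono {s s' t t' : Set (Arrow X)} (h : s ⊆ s') (h' : t ⊆ t') :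
    arrowMul s t ⊆ arrowMul s' t' := by
  rintro _ ⟨g, hg, k, hk, e, rfl⟩
  exact ⟨g, h hg, k, h' hk, e, rfl⟩

theorem arrowMul_subset_arrowSet {S : Subgroupoid X} {s t : Set (Arrow X)}
    (hs : s ⊆ arrowSet S) (ht : t ⊆ arrowSet S) : arrowMul s t ⊆ arrowSet S := by
  rintro _ ⟨g, hg, k, hk, e, rfl⟩
  exact groupoidMul_mem_arrowSet (hs hg) (ht hk) e

end GroupoidAlgebra

section GroupoidTopology

/-! ### Topology of étale groupoids -/

variable {X : Type u} [Groupoid.{v} X] [TopologicalSpace X] [TopologicalSpace (Arrow X)]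
  [EtaleGroupoid X]

namespace EtaleGroupoid

theorem isClosedEmbedding_unit : Topology.IsClosedEmbedding fun x : X => Arrow.mk (𝟙 x) :=
  haveI := EtaleGroupoid.t2 (X := X)
  Function.LeftInverse.isClosedEmbedding (f := fun g : Arrow X => g.left) (fun _ => rfl)
    (source_isLocalHomeomorph (X := X)).continuous continuous_unit

theorem t2_units : T2Space X :=
  haveI := EtaleGroupoid.t2 (X := X)
  (isClosedEmbedding_unit (X := X)).isEmbedding.t2Space

theorem locallyCompact_units : LocallyCompactSpace X :=
  haveI := EtaleGroupoid.locallyCompact (X := X)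
  (isClosedEmbedding_unit (X := X)).locallyCompactSpace

theorem secondCountable_units [SecondCountableTopology (Arrow X)] : SecondCountableTopology X :=
  (isClosedEmbedding_unit (X := X)).isEmbedding.secondCountableTopology

theorem normal_units [SecondCountableTopology (Arrow X)] : NormalSpace X :=
  haveI := t2_units (X := X)
  haveI := locallyCompact_units (X := X)
  haveI := secondCountable_units (X := X)
  inferInstance

theorem continuous_source : Continuous fun g : Arrow X => g.left :=
  (source_isLocalHomeomorph (X := X)).continuous

theorem isOpenMap_range : IsOpenMap fun g : Arrow X => g.right := by
  intro U hU
  have h : (fun g : Arrow X => g.right) '' U =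
      (fun g : Arrow X => g.left) '' (groupoidInv ⁻¹' U) := by
    ext x
    constructor
    · rintro ⟨g, hg, rfl⟩
      exact ⟨groupoidInv g, by rwa [Set.mem_preimage, groupoidInv_groupoidInv], rfl⟩
    · rintro ⟨g, hg, rfl⟩
      exact ⟨groupoidInv g, hg, rfl⟩
  rw [h]
  exact (source_isLocalHomeomorph (X := X)).isOpenMap _ (hU.preimage continuous_inv)

end EtaleGroupoid

theorem IsCompact.arrowMul {s t : Set (Arrow X)} (hs : IsCompact s) (ht : IsCompact t) :
    IsCompact (arrowMul s t) := by
  have := EtaleGroupoid.t2_units (X := X)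
  have hclosed : IsClosed {p : Arrow X × Arrow X | p.1.left = p.2.right} :=
    isClosed_eq (EtaleGroupoid.continuous_source.comp continuous_fst)
      (EtaleGroupoid.continuous_range.comp continuous_snd)
  have h := (hclosed.isClosedEmbedding_subtypeVal.isCompact_preimage (hs.prod ht)).image
    (EtaleGroupoid.continuous_mul (X := X))
  convert h using 1
  ext m
  constructor
  · rintro ⟨g, hg, k, hk, e, rfl⟩
    exact ⟨⟨(g, k), e⟩, ⟨hg, hk⟩, rfl⟩
  · rintro ⟨⟨⟨g, k⟩, e⟩, ⟨hg, hk⟩, rfl⟩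
    exact ⟨g, hg, k, hk, e, rfl⟩

theorem IsCompact.image_groupoidInv {s : Set (Arrow X)} (hs : IsCompact s) :
    IsCompact (groupoidInv '' s) :=
  hs.image EtaleGroupoid.continuous_inv

end GroupoidTopology

section Convolution

/-! ### Convolution of functions in `C_c(G)` -/

variable {X : Type u} [Groupoid.{v} X] [TopologicalSpace (Arrow X)]

/-- The pointwise product of a continuous function with a function in `C_c(G)`. -/
noncomputable def weighted (f : C(Arrow X, ℂ)) (a : C_c(Arrow X, ℂ)) : C_c(Arrow X, ℂ) where
  toFun g := f g * a g
  continuous_toFun := f.continuous.mul a.continuous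
  hasCompactSupport' := a.hasCompactSupport.mul_left

@[simp]
theorem weighted_apply (f : C(Arrow X, ℂ)) (a : C_c(Arrow X, ℂ)) (g : Arrow X) :
    weighted f a g = f g * a g :=
  rfl

theorem tsupport_weighted_subset (f : C(Arrow X, ℂ)) (a : C_c(Arrow X, ℂ)) :
    tsupport (weighted f a) ⊆ tsupport a :=
  tsupport_mul_subset_right

theorem tsupport_weighted_subset_left (f : C(Arrow X, ℂ)) (a : C_c(Arrow X, ℂ)) :
    tsupport (weighted f a) ⊆ tsupport f :=
  tsupport_mul_subset_left

variable [TopologicalSpace X] [EtaleGroupoid X]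

theorem entry_leftConvolution (a : C_c(Arrow X, ℂ)) (g k : Arrow X) :
    entry (leftConvolution a) g k = convolutionKernel a g k :=
  entry_eq_of_apply (leftConvolution_apply a) g k

theorem leftConvolution_add (a b : C_c(Arrow X, ℂ)) :
    leftConvolution (a + b) = leftConvolution a + leftConvolution b := by
  refine entry_injective fun g k => ?_
  simp only [entry_add, entry_leftConvolution, convolutionKernel]
  split_ifs <;> simp

theorem leftConvolution_smul (c : ℂ) (a : C_c(Arrow X, ℂ)) :
    leftConvolution (c • a) = c • leftConvolution a := by
  refine entry_injective fun g k => ?_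
  simp only [entry_smul, entry_leftConvolution, convolutionKernel]
  split_ifs <;> simp

theorem leftConvolution_zero : leftConvolution (0 : C_c(Arrow X, ℂ)) = 0 := by
  simpa using leftConvolution_smul 0 (0 : C_c(Arrow X, ℂ))

/-- The adjoint of `a ∈ C_c(G)` is `g ↦ conj (a g⁻¹)`. -/
theorem exists_leftConvolution_eq_star (a : C_c(Arrow X, ℂ)) :
    ∃ b : C_c(Arrow X, ℂ), tsupport b ⊆ groupoidInv '' tsupport a ∧
      leftConvolution b = star (leftConvolution a) := by
  have := EtaleGroupoid.t2 (X := X)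
  have hc := (a.hasCompactSupport.isCompact).image_groupoidInv
  have hsub : ∀ g, g ∉ groupoidInv '' tsupport a → star (a (groupoidInv g)) = 0 := by
    intro g hg
    rw [star_eq_zero]
    by_contra h
    exact hg ⟨_, subset_tsupport _ h, groupoidInv_groupoidInv g⟩
  refine ⟨⟨⟨fun g => star (a (groupoidInv g)),
    (a.continuous.comp EtaleGroupoid.continuous_inv).star⟩, HasCompactSupport.intro hc hsub⟩,
    closure_minimal (fun g hg => ?_) hc.isClosed, entry_injective fun g k => ?_⟩
  · by_contra h
    exact hg (hsub g h)
  · rw [entry_star, entry_leftConvolution, entry_leftConvolution, convolutionKernel,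
      convolutionKernel]
    by_cases e : g.left = k.left
    · rw [dif_pos e, dif_pos e.symm]
      change star (a (groupoidInv (groupoidMul g (groupoidInv k) e))) = _
      congr 2
      refine (groupoidInv_groupoidMul (h := groupoidInv k) e).trans ?_
      congr 1
      exact groupoidInv_groupoidInv k
    · rw [dif_neg e, dif_neg (Ne.symm e), star_zero]

/-- The convolution of `a` with a function `b` supported in an open set on which the source map
is injective: if `σ` is the local inverse of the source map, it is
`m ↦ a (m σ(s(m))⁻¹) b (σ(s(m)))`, which is continuous since it involves no sum. -/
theorem exists_leftConvolution_eq_mul_of_bisection (a b : C_c(Arrow X, ℂ))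
    (e : OpenPartialHomeomorph (Arrow X) X) (he : (fun g : Arrow X => g.left) = e)
    (hb : tsupport b ⊆ e.source) :
    ∃ c : C_c(Arrow X, ℂ), tsupport c ⊆ arrowMul (tsupport a) (tsupport b) ∧
      leftConvolution c = leftConvolution a * leftConvolution b := by
  classical
  have := EtaleGroupoid.t2 (X := X)
  have := EtaleGroupoid.t2_units (X := X)
  have heq : ∀ g : Arrow X, e g = g.left := fun g => (congr_fun he g).symm
  have hσ : ∀ {x : X}, x ∈ e.target → (e.symm x).left = x := fun hx => by
    rw [← heq, e.right_inv hx]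
  have hσ' : ∀ {g : Arrow X}, g ∈ e.source → e.symm g.left = g := fun hg => by
    rw [← heq, e.left_inv hg]
  have htgt : ∀ {g : Arrow X}, g ∈ e.source → g.left ∈ e.target := fun hg => by
    rw [← heq]; exact e.map_source hg
  let c : Arrow X → ℂ := fun m =>
    if h : m.left ∈ e.target then
      a (groupoidMul m (groupoidInv (e.symm m.left)) (hσ h).symm) * b (e.symm m.left) else 0
  have hc : ∀ {m : Arrow X} (h : m.left ∈ e.target), c m =
      a (groupoidMul m (groupoidInv (e.symm m.left)) (hσ h).symm) * b (e.symm m.left) :=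
    fun h => dif_pos h
  have hcomp : IsCompact (arrowMul (tsupport a) (tsupport b)) :=
    a.hasCompactSupport.isCompact.arrowMul b.hasCompactSupport.isCompact
  have hsupp : ∀ m, m ∉ arrowMul (tsupport a) (tsupport b) → c m = 0 := by
    intro m hm
    by_cases h : m.left ∈ e.target
    · rw [hc h]
      by_contra hne
      refine hm ⟨_, subset_tsupport _ (left_ne_zero_of_mul hne), _,
        subset_tsupport _ (right_ne_zero_of_mul hne), rfl, ?_⟩
      exact (groupoidMul_mul_inv_cancel (hσ h).symm).symm
    · exact dif_neg h
  have hcont : Continuous c := by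
    rw [continuous_iff_continuousAt]
    intro m₀
    by_cases h₀ : m₀.left ∈ e.target
    · have hopen : IsOpen {m : Arrow X | m.left ∈ e.target} :=
        e.open_target.preimage EtaleGroupoid.continuous_source
      refine ContinuousOn.continuousAt ?_ (hopen.mem_nhds h₀)
      rw [continuousOn_iff_continuous_domRestrict]
      have hs : Continuous fun m : {m : Arrow X | m.left ∈ e.target} => e.symm m.1.left :=
        e.continuousOn_symm.comp_continuous
          (EtaleGroupoid.continuous_source.comp continuous_subtype_val) fun m => m.2
      have hmul : Continuous fun m : {m : Arrow X | m.left ∈ e.target} =>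
          groupoidMul m.1 (groupoidInv (e.symm m.1.left)) (hσ m.2).symm :=
        (EtaleGroupoid.continuous_mul (X := X)).comp
          (f := fun m : {m : Arrow X | m.left ∈ e.target} =>
            (⟨(m.1, groupoidInv (e.symm m.1.left)), (hσ m.2).symm⟩ :
              {p : Arrow X × Arrow X // p.1.left = p.2.right}))
          ((continuous_subtype_val.prodMk
            (EtaleGroupoid.continuous_inv.comp hs)).subtype_mk _)
      convert (a.continuous.comp hmul).mul (b.continuous.comp hs) using 1
      exact funext fun m => hc m.2
    · have hclosed : IsClosed ((fun g : Arrow X => g.left) '' tsupport b) :=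
        (b.hasCompactSupport.isCompact.image EtaleGroupoid.continuous_source).isClosed
      have hmem : m₀ ∈ (fun g : Arrow X => g.left) ⁻¹'
          ((fun g : Arrow X => g.left) '' tsupport b)ᶜ := by
        rintro ⟨g, hg, hgm⟩
        have hgm : g.left = m₀.left := hgm
        exact h₀ (hgm ▸ htgt (hb hg))
      refine (continuousAt_const (y := (0 : ℂ))).congr ?_
      filter_upwards [(hclosed.isOpen_compl.preimage
        EtaleGroupoid.continuous_source).mem_nhds hmem] with m hm
      by_cases h : m.left ∈ e.target
      · rw [hc h]
        by_contra hne
        exact hm ⟨_, subset_tsupport _ (right_ne_zero_of_mul (Ne.symm hne)), hσ h⟩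
      · exact ((dif_neg h : c m = 0)).symm
  refine ⟨⟨⟨c, hcont⟩, HasCompactSupport.intro hcomp hsupp⟩,
    closure_minimal (fun m hm => ?_) hcomp.isClosed, entry_injective fun g k => ?_⟩
  · by_contra h
    exact hm (hsupp m h)
  rw [entry_leftConvolution]
  refine (HasSum.unique ?_ (hasSum_entry_mul_entry (leftConvolution a) (leftConvolution b) g k))
  simp only [entry_leftConvolution]
  have hne : ∀ {j}, convolutionKernel a g j * convolutionKernel b j k ≠ 0 →
      ∃ (_ : g.left = j.left) (e₂ : j.left = k.left),
        groupoidMul j (groupoidInv k) e₂ ∈ e.source := by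
    intro j hj
    have h1 := left_ne_zero_of_mul hj
    have h2 := right_ne_zero_of_mul hj
    simp only [convolutionKernel] at h1 h2
    split_ifs at h1 h2 with e₁ e₂
    · exact ⟨e₁, e₂, hb (subset_tsupport _ h2)⟩
    all_goals simp at h1 h2
  by_cases hk : k.right ∈ e.target ∧ g.left = k.left
  · obtain ⟨hk, hgk⟩ := hk
    have hl : (e.symm k.right).left = k.right := hσ hk
    convert hasSum_single (groupoidMul (e.symm k.right) k hl) fun j hj => ?_ using 1
    · have h1 : g.left = (groupoidMul (e.symm k.right) k hl).left := hgk
      have h2 : (groupoidMul (e.symm k.right) k hl).left = k.left := rfl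
      simp only [convolutionKernel]
      rw [dif_pos hgk, dif_pos h1, dif_pos h2, groupoidMul_mul_inv_cancel_right hl]
      change c _ = _
      rw [hc (m := groupoidMul g (groupoidInv k) hgk) hk]
      congr 2
      exact (groupoidMul_inv_groupoidMul hl hgk).symm
    · by_contra hne'
      obtain ⟨e₁, e₂, h⟩ := hne hne'
      have h3 : e.symm k.right = groupoidMul j (groupoidInv k) e₂ := hσ' h
      apply hj
      have h4 := groupoidMul_mul_inv_cancel e₂
      simp only [← h3] at h4
      exact h4.symm
  · have hz : convolutionKernel (⟨⟨c, hcont⟩, HasCompactSupport.intro hcomp hsupp⟩ :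
        C_c(Arrow X, ℂ)) g k = 0 := by
      simp only [convolutionKernel]
      split_ifs with hgk
      · exact dif_neg fun h => hk ⟨h, hgk⟩
      · rfl
    rw [hz]
    convert hasSum_zero with j
    by_contra hne'
    obtain ⟨e₁, e₂, h⟩ := hne hne'
    exact hk ⟨htgt h, e₁.trans e₂⟩

/-- `C_c(G)` is closed under convolution: a partition of unity reduces this to functions supported
in open sets on which the source map is injective. -/
theorem exists_leftConvolution_eq_mul (a b : C_c(Arrow X, ℂ)) :
    ∃ c : C_c(Arrow X, ℂ), tsupport c ⊆ arrowMul (tsupport a) (tsupport b) ∧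
      leftConvolution c = leftConvolution a * leftConvolution b := by
  have := EtaleGroupoid.t2 (X := X)
  have := EtaleGroupoid.locallyCompact (X := X)
  have hb := b.hasCompactSupport.isCompact
  choose e hmem he using EtaleGroupoid.source_isLocalHomeomorph (X := X)
  obtain ⟨t, ht⟩ := hb.elim_finite_subcover (fun g => (e g).source) (fun g => (e g).open_source)
    fun g _ => Set.mem_iUnion.2 ⟨g, hmem g⟩
  let τ := t.equivFin.symm
  obtain ⟨f, hf, hsum, -, -⟩ := exists_continuous_sum_one_of_isOpen_isCompact
    (s := fun i => (e (τ i)).source) (fun i => (e (τ i)).open_source) hb fun g hg => by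
      obtain ⟨k, hk, hgk⟩ := Set.mem_iUnion₂.1 (ht hg)
      exact Set.mem_iUnion.2 ⟨t.equivFin ⟨k, hk⟩, by simpa [τ] using hgk⟩
  let F : ∀ i, C(Arrow X, ℂ) := fun i => ⟨fun g => (f i g : ℂ), by fun_prop⟩
  have hbsum : b = ∑ i, weighted (F i) b := by
    ext g
    rw [CompactlySupportedContinuousMap.sum_apply]
    simp only [weighted_apply, ← Finset.sum_mul]
    by_cases hg : g ∈ tsupport b
    · have h1 := hsum hg
      rw [Finset.sum_apply, Pi.one_apply] at h1
      have : ∑ i, F i g = 1 := by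
        change ∑ i, (f i g : ℂ) = 1
        exact_mod_cast h1
      rw [this, one_mul]
    · rw [image_eq_zero_of_notMem_tsupport hg, mul_zero]
  have hFs : ∀ i, tsupport (weighted (F i) b) ⊆ (e (τ i)).source := by
    intro i
    refine (tsupport_weighted_subset_left _ _).trans (subset_trans ?_ (hf i))
    exact closure_mono fun g hg h => hg (by simp [F, h])
  have hclosed : IsClosed (arrowMul (tsupport a) (tsupport b)) :=
    (a.hasCompactSupport.isCompact.arrowMul hb).isClosed
  rw [hbsum]
  have key : ∃ c : C_c(Arrow X, ℂ), tsupport c ⊆ arrowMul (tsupport a) (tsupport b) ∧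
      leftConvolution c = leftConvolution a * leftConvolution (∑ i, weighted (F i) b) := by
    refine Finset.sum_induction (fun i => weighted (F i) b) (fun d => ∃ c : C_c(Arrow X, ℂ),
      tsupport c ⊆ arrowMul (tsupport a) (tsupport b) ∧
        leftConvolution c = leftConvolution a * leftConvolution d) ?_ ?_ fun i _ => ?_
    · rintro d d' ⟨c, hc, h⟩ ⟨c', hc', h'⟩
      refine ⟨c + c', (tsupport_add _ _).trans (Set.union_subset hc hc'), ?_⟩
      rw [leftConvolution_add, leftConvolution_add, mul_add, h, h']
    · exact ⟨0, by simp [tsupport], by simp [leftConvolution_zero]⟩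
    · obtain ⟨c, hc, h⟩ := exists_leftConvolution_eq_mul_of_bisection a (weighted (F i) b) (e (τ i))
        (he (τ i)) (hFs i)
      exact ⟨c, hc.trans (arrowMul_mono subset_rfl (tsupport_weighted_subset _ _)), h⟩
  rwa [← hbsum] at key ⊢

/-- The *-algebra `C_c(S)` of an open subgroupoid `S`, represented by left convolution. -/
def convolutionAlgebra (S : Subgroupoid X) :
    NonUnitalStarSubalgebra ℂ (groupoidL2 X →L[ℂ] groupoidL2 X) where
  carrier := {T | ∃ a : C_c(Arrow X, ℂ), tsupport a ⊆ arrowSet S ∧ leftConvolution a = T}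
  add_mem' := by
    rintro _ _ ⟨a, ha, rfl⟩ ⟨b, hb, rfl⟩
    exact ⟨a + b, (tsupport_add _ _).trans (Set.union_subset ha hb), leftConvolution_add a b⟩
  zero_mem' := ⟨0, by simp [tsupport], leftConvolution_zero⟩
  mul_mem' := by
    rintro _ _ ⟨a, ha, rfl⟩ ⟨b, hb, rfl⟩
    obtain ⟨c, hc, h⟩ := exists_leftConvolution_eq_mul a b
    exact ⟨c, hc.trans (arrowMul_subset_arrowSet ha hb), h⟩
  smul_mem' := by
    rintro z _ ⟨a, ha, rfl⟩
    exact ⟨z • a, (closure_mono (Function.support_const_smul_subset z a)).trans ha,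
      leftConvolution_smul z a⟩
  star_mem' := by
    rintro _ ⟨a, ha, rfl⟩
    obtain ⟨b, hb, h⟩ := exists_leftConvolution_eq_star a
    refine ⟨b, hb.trans ?_, h⟩
    rintro _ ⟨g, hg, rfl⟩
    exact groupoidInv_mem_arrowSet (ha hg)

theorem denseRange_toReduced : DenseRange (toReduced (X := X)) := by
  intro T
  have hle : NonUnitalStarAlgebra.adjoin ℂ (Set.range (leftConvolution (X := X))) ≤
      convolutionAlgebra ⊤ := by
    rw [NonUnitalStarAlgebra.adjoin_le_iff]
    rintro _ ⟨a, rfl⟩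
    exact ⟨a, by simp [arrowSet_top], rfl⟩
  have hT : (T : groupoidL2 X →L[ℂ] groupoidL2 X) ∈
      closure (convolutionAlgebra (⊤ : Subgroupoid X) : Set (groupoidL2 X →L[ℂ] groupoidL2 X)) :=
    closure_mono hle T.2
  rw [closure_subtype]
  convert hT using 2
  ext U
  constructor
  · rintro ⟨_, ⟨a, rfl⟩, rfl⟩
    exact ⟨a, by simp [arrowSet_top], rfl⟩
  · rintro ⟨a, -, rfl⟩
    exact ⟨toReduced a, ⟨a, rfl⟩, rfl⟩

theorem subgroupoidAlgebra_subset_closure (S : Subgroupoid X) :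
    (subgroupoidAlgebra S : Set (reducedCStarAlgebra X)) ⊆
      closure {T | ∃ a : C_c(Arrow X, ℂ), tsupport a ⊆ arrowSet S ∧ T = toReduced a} := by
  have hle : NonUnitalStarAlgebra.adjoin ℂ
      {T | ∃ a : C_c(Arrow X, ℂ), tsupport a ⊆ arrowSet S ∧ T = toReduced a} ≤
      (convolutionAlgebra S).comap
        (NonUnitalStarSubalgebraClass.subtype (reducedCStarAlgebra X)) := by
    rw [NonUnitalStarAlgebra.adjoin_le_iff]
    rintro _ ⟨a, ha, rfl⟩
    exact ⟨a, ha, rfl⟩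
  refine closure_mono fun T hT => ?_
  obtain ⟨a, ha, h⟩ := hle hT
  exact ⟨a, ha, Subtype.ext h.symm⟩

theorem toReduced_mem_subgroupoidAlgebra {S : Subgroupoid X} {a : C_c(Arrow X, ℂ)}
    (ha : tsupport a ⊆ arrowSet S) : toReduced a ∈ subgroupoidAlgebra S :=
  NonUnitalStarSubalgebra.le_topologicalClosure _
    (NonUnitalStarAlgebra.subset_adjoin ℂ _ ⟨a, ha, rfl⟩)

theorem isClosed_subgroupoidAlgebra (S : Subgroupoid X) :
    IsClosed (subgroupoidAlgebra S : Set (reducedCStarAlgebra X)) :=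
  NonUnitalStarSubalgebra.isClosed_topologicalClosure _

end Convolution

section Multipliers

/-! ### Functions on the unit space as multipliers -/

variable {X : Type u} [Groupoid.{v} X] [TopologicalSpace X] [TopologicalSpace (Arrow X)]

/-- Multiplication by `f ∘ r` on `ℓ²(G)`, for a function `f` on the unit space. -/
noncomputable def unitDiagonal (f : C(X, ℝ)) : groupoidL2 X →L[ℂ] groupoidL2 X :=
  diagonal fun g : Arrow X => (f g.right : ℂ)

variable [EtaleGroupoid X]

/-- The function `f ∘ r` on the groupoid. -/
noncomputable def rangeWeight (f : C(X, ℝ)) : C(Arrow X, ℂ) :=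
  ⟨fun g => (f g.right : ℂ),
    Complex.continuous_ofReal.comp (f.continuous.comp EtaleGroupoid.continuous_range)⟩

/-- The function `f ∘ s` on the groupoid. -/
noncomputable def sourceWeight (f : C(X, ℝ)) : C(Arrow X, ℂ) :=
  ⟨fun g => (f g.left : ℂ),
    Complex.continuous_ofReal.comp (f.continuous.comp EtaleGroupoid.continuous_source)⟩

theorem tsupport_rangeWeight_subset (f : C(X, ℝ)) :
    tsupport (rangeWeight f) ⊆ {g : Arrow X | g.right ∈ tsupport f} := by
  refine closure_minimal (fun g hg => subset_tsupport _ fun h => hg ?_)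
    ((isClosed_tsupport _).preimage EtaleGroupoid.continuous_range)
  change (f g.right : ℂ) = 0
  rw [h, Complex.ofReal_zero]

theorem unitDiagonal_mul_leftConvolution {f : C(X, ℝ)} (hf : ∀ x, |f x| ≤ 1)
    (a : C_c(Arrow X, ℂ)) :
    unitDiagonal f * leftConvolution a = leftConvolution (weighted (rangeWeight f) a) := by
  refine entry_injective fun g k => ?_
  rw [unitDiagonal, entry_diagonal_mul (fun g : Arrow X => by simpa using hf g.right),
    entry_leftConvolution, entry_leftConvolution, convolutionKernel, convolutionKernel]
  split_ifs
  · rfl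
  · rw [mul_zero]

theorem leftConvolution_mul_unitDiagonal {f : C(X, ℝ)} (hf : ∀ x, |f x| ≤ 1)
    (a : C_c(Arrow X, ℂ)) :
    leftConvolution a * unitDiagonal f = leftConvolution (weighted (sourceWeight f) a) := by
  refine entry_injective fun g k => ?_
  rw [unitDiagonal, entry_mul_diagonal (fun g : Arrow X => by simpa using hf g.right),
    entry_leftConvolution, entry_leftConvolution, convolutionKernel, convolutionKernel]
  split_ifs
  · exact mul_comm _ _
  · rw [zero_mul]

theorem isClosed_reducedCStarAlgebra :
    IsClosed (reducedCStarAlgebra X : Set (groupoidL2 X →L[ℂ] groupoidL2 X)) :=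
  NonUnitalStarSubalgebra.isClosed_topologicalClosure _

theorem unitDiagonal_mul_mem {f : C(X, ℝ)} (hf : ∀ x, |f x| ≤ 1) (T : reducedCStarAlgebra X) :
    unitDiagonal f * (T : groupoidL2 X →L[ℂ] groupoidL2 X) ∈ reducedCStarAlgebra X := by
  refine denseRange_toReduced.induction_on T
    (isClosed_reducedCStarAlgebra.preimage (by fun_prop)) fun a => ?_
  change unitDiagonal f * leftConvolution a ∈ _
  rw [unitDiagonal_mul_leftConvolution hf]
  exact (toReduced _).2

theorem mul_unitDiagonal_mem {f : C(X, ℝ)} (hf : ∀ x, |f x| ≤ 1) (T : reducedCStarAlgebra X) :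
    (T : groupoidL2 X →L[ℂ] groupoidL2 X) * unitDiagonal f ∈ reducedCStarAlgebra X := by
  refine denseRange_toReduced.induction_on T
    (isClosed_reducedCStarAlgebra.preimage (by fun_prop)) fun a => ?_
  change leftConvolution a * unitDiagonal f ∈ _
  rw [leftConvolution_mul_unitDiagonal hf]
  exact (toReduced _).2

/-- A continuous function on the unit space with values in `[-1, 1]`, as a multiplier of `C*_r(G)`. -/
noncomputable def unitMultiplier (f : C(X, ℝ)) (hf : ∀ x, |f x| ≤ 1) :
    DoubleCentralizer ℂ (reducedCStarAlgebra X) where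
  fst := LinearMap.mkContinuous
    { toFun := fun T => ⟨unitDiagonal f * T, unitDiagonal_mul_mem hf T⟩
      map_add' := fun S T => Subtype.ext (mul_add (unitDiagonal f) S.1 T.1)
      map_smul' := fun c T => Subtype.ext (mul_smul_comm c (unitDiagonal f) T.1) } 1 fun T =>
        (norm_mul_le (unitDiagonal f) T.1).trans
          (mul_le_mul_of_nonneg_right (norm_diagonal_le _) (norm_nonneg _))
  snd := LinearMap.mkContinuous
    { toFun := fun T => ⟨T * unitDiagonal f, mul_unitDiagonal_mem hf T⟩
      map_add' := fun S T => Subtype.ext (add_mul S.1 T.1 (unitDiagonal f))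
      map_smul' := fun c T => Subtype.ext (smul_mul_assoc c T.1 (unitDiagonal f)) } 1 fun T =>
        (norm_mul_le T.1 (unitDiagonal f)).trans <| by
          rw [mul_comm]
          exact mul_le_mul_of_nonneg_right (norm_diagonal_le _) (norm_nonneg _)
  central := fun S T => Subtype.ext (mul_assoc S.1 (unitDiagonal f) T.1)

theorem norm_unitMultiplier_le (f : C(X, ℝ)) (hf : ∀ x, |f x| ≤ 1) : ‖unitMultiplier f hf‖ ≤ 1 := by
  rw [← DoubleCentralizer.norm_fst]
  refine ContinuousLinearMap.opNorm_le_bound _ zero_le_one fun T => ?_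
  exact (norm_mul_le (unitDiagonal f) T.1).trans
    (mul_le_mul_of_nonneg_right (norm_diagonal_le _) (norm_nonneg _))

/-- Multiplication by a function with values in `[0, 1]` is a positive contraction, since it is the
square of multiplication by the square root of the function. -/
theorem exists_isPositiveContraction (f : C(X, ℝ)) (h0 : ∀ x, 0 ≤ f x) (h1 : ∀ x, f x ≤ 1) :
    ∃ m : DoubleCentralizer ℂ (reducedCStarAlgebra X), IsPositiveContraction m ∧
      (∀ T, (m.fst T : groupoidL2 X →L[ℂ] groupoidL2 X) = unitDiagonal f * T) ∧
      ∀ T, (m.snd T : groupoidL2 X →L[ℂ] groupoidL2 X) = T * unitDiagonal f := by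
  let k : C(X, ℝ) := ⟨fun x => √(f x), by fun_prop⟩
  have hk : ∀ x, |k x| ≤ 1 := fun x => by
    change |√(f x)| ≤ 1
    rw [abs_of_nonneg (Real.sqrt_nonneg _)]
    exact Real.sqrt_le_one.2 (h1 x)
  have hkk : unitDiagonal k * unitDiagonal k = unitDiagonal f := by
    refine entry_injective fun g j => ?_
    rw [unitDiagonal, unitDiagonal, entry_diagonal_mul (fun g : Arrow X => by simpa using hk g.right),
      entry_diagonal (fun g : Arrow X => by simpa using hk g.right),
      entry_diagonal (fun g : Arrow X => by simpa [abs_of_nonneg (h0 _)] using h1 g.right)]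
    split_ifs
    · rw [← Complex.ofReal_mul]
      congr 1
      exact Real.mul_self_sqrt (h0 _)
    · rw [mul_zero]
  have hstar : star (unitDiagonal k) = unitDiagonal k :=
    star_diagonal (fun g : Arrow X => by simpa using hk g.right) fun g => Complex.conj_ofReal _
  refine ⟨star (unitMultiplier k hk) * unitMultiplier k hk, ⟨⟨_, rfl⟩, ?_⟩, fun T => ?_,
    fun T => ?_⟩
  · rw [CStarRing.norm_star_mul_self]
    exact mul_le_one₀ (norm_unitMultiplier_le k hk) (norm_nonneg _) (norm_unitMultiplier_le k hk)
  · rw [DoubleCentralizer.mul_fst, mul_apply_eq_comp, DoubleCentralizer.star_fst]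
    change star (star (unitDiagonal k * (T : groupoidL2 X →L[ℂ] groupoidL2 X)) * unitDiagonal k) = _
    rw [star_mul, star_star, hstar, ← mul_assoc, hkk]
  · rw [DoubleCentralizer.mul_snd, mul_apply_eq_comp, DoubleCentralizer.star_snd]
    change star (unitDiagonal k * star (T : groupoidL2 X →L[ℂ] groupoidL2 X)) * unitDiagonal k = _
    rw [star_mul, star_star, hstar, mul_assoc, hkk]

/-- The norm of a function supported in a fixed compact set is controlled by its supremum. -/
theorem exists_norm_weighted_le (a : C_c(Arrow X, ℂ)) : ∃ C : ℝ, 0 ≤ C ∧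
    ∀ (f : C(Arrow X, ℂ)) (ε : ℝ), 0 ≤ ε → (∀ g ∈ tsupport a, ‖f g‖ ≤ ε) →
      ‖leftConvolution (weighted f a)‖ ≤ C * ε := by
  have hsrc := EtaleGroupoid.source_isLocalHomeomorph (X := X)
  have hL : IsCompact (tsupport a) := a.hasCompactSupport
  obtain ⟨N, hN⟩ := exists_fibre_bound hsrc hL
  obtain ⟨N', hN'⟩ := exists_fibre_bound hsrc (hL.image EtaleGroupoid.continuous_inv)
  obtain ⟨M, hM⟩ : ∃ M : ℝ, ∀ g, ‖a g‖ ≤ M :=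
    a.hasCompactSupport.exists_bound_of_continuous a.continuous
  refine ⟨(N + N' : ℕ) * |M|, by positivity, fun f ε hε hf => ?_⟩
  have hsupp : ∀ {g k}, entry (leftConvolution (weighted f a)) g k ≠ 0 →
      ∃ e : g.left = k.left, groupoidMul g (groupoidInv k) e ∈ tsupport a := by
    intro g k h
    rw [entry_leftConvolution, convolutionKernel] at h
    split_ifs at h with e
    · exact ⟨e, subset_tsupport _ (right_ne_zero_of_mul h)⟩
    · exact absurd rfl h
  rw [mul_assoc]
  refine norm_le_of_entry _ (N + N') (|M| * ε) (by positivity) (fun g k => ?_) (fun g => ?_)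
    fun k => ?_
  · by_cases h : entry (leftConvolution (weighted f a)) g k = 0
    · rw [h, norm_zero]
      positivity
    obtain ⟨e, he⟩ := hsupp h
    rw [entry_leftConvolution, convolutionKernel, dif_pos e, weighted_apply, norm_mul, mul_comm]
    exact mul_le_mul ((hM _).trans (le_abs_self M)) (hf _ he) (norm_nonneg _) (abs_nonneg _)
  · refine le_trans ?_ ((hN' g.right).trans (by exact_mod_cast Nat.le_add_left _ _))
    classical
    refine Set.encard_le_encard_of_injOn
      (f := fun k => if e : g.left = k.left then groupoidInv (groupoidMul g (groupoidInv k) e) else k)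
      ?_ ?_
    · intro k hk
      obtain ⟨e, h⟩ := hsupp hk
      simp only [dif_pos e]
      exact ⟨⟨_, h, rfl⟩, rfl⟩
    · intro k hk k' hk' h
      obtain ⟨e, -⟩ := hsupp hk
      obtain ⟨e', -⟩ := hsupp hk'
      simp only [dif_pos e, dif_pos e'] at h
      rw [← groupoidMul_inv_mul_cancel e, ← groupoidMul_inv_mul_cancel e']
      congr 1
  · refine le_trans ?_ ((hN k.right).trans (by exact_mod_cast Nat.le_add_right _ _))
    classical
    refine Set.encard_le_encard_of_injOn
      (f := fun g => if e : g.left = k.left then groupoidMul g (groupoidInv k) e else g)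
      ?_ ?_
    · intro g hg
      obtain ⟨e, h⟩ := hsupp hg
      simp only [dif_pos e]
      exact ⟨h, rfl⟩
    · intro g hg g' hg' h
      obtain ⟨e, -⟩ := hsupp hg
      obtain ⟨e', -⟩ := hsupp hg'
      simp only [dif_pos e, dif_pos e'] at h
      rw [← groupoidMul_mul_inv_cancel e, ← groupoidMul_mul_inv_cancel e']
      congr 1

end Multipliers

section AlmostInvariant

/-! ### Almost invariant functions on the unit space -/

/-- A Urysohn function that is `1` on a neighbourhood `V` of `C`, so that the support of `1 - f` stays
off `C`. -/
theorem exists_bump {Y : Type*} [TopologicalSpace Y] [NormalSpace Y] {C U : Set Y}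
    (hC : IsClosed C) (hU : IsOpen U) (hCU : C ⊆ U) :
    ∃ f : C(Y, ℝ), (∀ y, f y ∈ Set.Icc 0 1) ∧ tsupport f ⊆ U ∧
      ∃ V, IsOpen V ∧ C ⊆ V ∧ ∀ y ∈ V, f y = 1 := by
  obtain ⟨V, hV, hCV, hVU⟩ := normal_exists_closure_subset hC hU hCU
  obtain ⟨W, hW, hVW, hWU⟩ := normal_exists_closure_subset isClosed_closure hU hVU
  obtain ⟨f, h0, h1, h01⟩ := exists_continuous_zero_one_of_isClosed hW.isClosed_compl
    isClosed_closure (Set.disjoint_compl_left_iff_subset.2 hVW)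
  refine ⟨f, h01, (closure_mono fun y hy => ?_).trans hWU, V, hV, hCV,
    fun y hy => h1 (subset_closure hy)⟩
  by_contra h
  exact hy (h0 h)

variable {X : Type u} [Groupoid.{v} X]

/-- The set `r(K ∩ s⁻¹(E))`, where `K` carries the subset `E` of the unit space. -/
def carry (K : Set (Arrow X)) (E : Set X) : Set X :=
  (fun g : Arrow X => g.right) '' {g ∈ K | g.left ∈ E}

/-- The points reached from `U` by at most `n` successive elements of `K`. -/
def expand (K : Set (Arrow X)) (U : Set X) : ℕ → Set X
  | 0 => U
  | n + 1 => expand K U n ∪ carry K (expand K U n)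

/-- The products of between `1` and `n` elements of `L`. -/
def powers (L : Set (Arrow X)) : ℕ → Set (Arrow X)
  | 0 => ∅
  | n + 1 => powers L n ∪ (L ∪ arrowMul L (powers L n))

theorem powers_mono (L : Set (Arrow X)) : Monotone (powers L) :=
  monotone_nat_of_le_succ fun _ => Set.subset_union_left

theorem mem_expand {K L : Set (Arrow X)} (hKL : K ⊆ L) {U : Set X} {n : ℕ} {x : X}
    (hx : x ∈ expand K U n) : x ∈ U ∨ ∃ q ∈ powers L n, q.left ∈ U ∧ q.right = x := by
  induction n generalizing x with
  | zero => exact Or.inl hx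
  | succ n ih =>
    rcases hx with hx | ⟨g, ⟨hg, hgx⟩, rfl⟩
    · rcases ih hx with h | ⟨q, hq, h⟩
      · exact Or.inl h
      · exact Or.inr ⟨q, Or.inl hq, h⟩
    · rcases ih hgx with h | ⟨q, hq, hqU, hqx⟩
      · exact Or.inr ⟨g, Or.inr (Or.inl (hKL hg)), h, rfl⟩
      · exact Or.inr ⟨groupoidMul g q hqx.symm, Or.inr (Or.inr ⟨g, hKL hg, q, hq, hqx.symm, rfl⟩),
          hqU, rfl⟩

/-- If `x = s(g)` is reached from `U` by a product `q`, then `g = (g q) q⁻¹`, where `g q` and `q` are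
products of elements of `L` with source in `U`. -/
theorem mem_arrowSet_of_mem_expand {K L W : Set (Arrow X)} (hKL : K ⊆ L) {U : Set X} {n : ℕ}
    (hW : powers L (n + 1) ⊆ W) {S : Subgroupoid X}
    (hS : generatedBy {g ∈ W | g.left ∈ U} ≤ S) {g : Arrow X} (hg : g ∈ L)
    (hx : g.left ∈ expand K U n) : g ∈ arrowSet S := by
  have hsub : ∀ q ∈ powers L (n + 1), q.left ∈ U → q ∈ arrowSet S := fun q hq hqU =>
    arrowSet_mono hS (subset_arrowSet_generatedBy _ ⟨hW hq, hqU⟩)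
  rcases mem_expand hKL hx with h | ⟨q, hq, hqU, hqx⟩
  · exact hsub g (Or.inr (Or.inl hg)) h
  · have h1 := hsub q (Or.inl hq) hqU
    have h2 := hsub (groupoidMul g q hqx.symm)
      (Or.inr (Or.inr ⟨g, hg, q, hq, hqx.symm, rfl⟩)) hqU
    rw [← groupoidMul_mul_inv_cancel_right hqx.symm]
    exact groupoidMul_mem_arrowSet h2 (groupoidInv_mem_arrowSet h1) rfl

/-- The averaging argument: an increasing sequence of functions, each of which is `1` on the
`K`-carry of the support of its predecessor, has almost `K`-invariant averages, because the sums
at the two ends of an element of `K` interlace. -/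
theorem abs_average_sub_le {K : Set (Arrow X)} (hK : ∀ g ∈ K, groupoidInv g ∈ K)
    (f : ℕ → X → ℝ) (h01 : ∀ j x, f j x ∈ Set.Icc (0 : ℝ) 1)
    (hf : ∀ j, ∀ g ∈ K, f j g.left ≠ 0 → f (j + 1) g.right = 1) (N : ℕ) {g : Arrow X} (hg : g ∈ K) :
    |(∑ j ∈ Finset.range (N + 1), f j g.right) / (N + 1) -
      (∑ j ∈ Finset.range (N + 1), f j g.left) / (N + 1)| ≤ 1 / (N + 1) := by
  -- passing from the source to the range shifts the index by one, at the cost of a boundary term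
  have hle : ∀ k ∈ K, ∑ j ∈ Finset.range (N + 1), f j k.left ≤
      (∑ j ∈ Finset.range (N + 1), f j k.right) + 1 := by
    intro k hk
    have h1 : ∑ j ∈ Finset.range (N + 1), f j k.left ≤
        ∑ j ∈ Finset.range (N + 1), f (j + 1) k.right := by
      refine Finset.sum_le_sum fun j _ => ?_
      by_cases h : f j k.left = 0
      · rw [h]; exact (h01 _ _).1
      · rw [hf j k hk h]; exact (h01 _ _).2
    have h2 := Finset.sum_range_succ' (fun j => f j k.right) (N + 1)
    have h3 := Finset.sum_range_succ (fun j => f j k.right) (N + 1)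
    linarith [(h01 0 k.right).1, (h01 (N + 1) k.right).2]
  have h1 := hle g hg
  have h2 := hle _ (hK g hg)
  change ∑ j ∈ Finset.range (N + 1), f j g.right ≤
    (∑ j ∈ Finset.range (N + 1), f j g.left) + 1 at h2
  rw [← sub_div, abs_div, abs_of_pos (by positivity : (0 : ℝ) < N + 1)]
  gcongr
  rw [abs_le]
  constructor <;> linarith

variable [TopologicalSpace X] [TopologicalSpace (Arrow X)] [EtaleGroupoid X]

theorem isOpen_carry {K : Set (Arrow X)} {E : Set X} (hK : IsOpen K) (hE : IsOpen E) :
    IsOpen (carry K E) :=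
  EtaleGroupoid.isOpenMap_range _ (hK.inter (hE.preimage EtaleGroupoid.continuous_source))

theorem isClosed_carry {K : Set (Arrow X)} {E : Set X} (hK : IsCompact K) (hE : IsClosed E) :
    IsClosed (carry K E) := by
  have := EtaleGroupoid.t2_units (X := X)
  exact ((hK.inter_right (hE.preimage EtaleGroupoid.continuous_source)).image
    EtaleGroupoid.continuous_range).isClosed

theorem isOpen_expand {K : Set (Arrow X)} {U : Set X} (hK : IsOpen K) (hU : IsOpen U) (n : ℕ) :
    IsOpen (expand K U n) := by
  induction n with
  | zero => exact hU
  | succ n ih => exact ih.union (isOpen_carry hK ih)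

theorem isCompact_powers {L : Set (Arrow X)} (hL : IsCompact L) (n : ℕ) :
    IsCompact (powers L n) := by
  induction n with
  | zero => exact isCompact_empty
  | succ n ih => exact ih.union (hL.union (hL.arrowMul ih))

/-- The function `h` on the unit space that gives the multiplier: it is almost invariant under `K`, and
the elements of `K` with range in the support of `h` or of `1 - h` lie in a member of `𝒟`. -/
theorem exists_almost_invariant [SecondCountableTopology (Arrow X)] {𝒟 : Set (Subgroupoid X)}
    (hdec : Decomposable (⊤ : Subgroupoid X) 𝒟) {K : Set (Arrow X)} (hK : IsCompact K)
    (hinv : ∀ g ∈ K, groupoidInv g ∈ K) (N : ℕ) :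
    ∃ h : C(X, ℝ), (∀ x, h x ∈ Set.Icc (0 : ℝ) 1) ∧
      (∀ g ∈ K, |h g.right - h g.left| ≤ 1 / (N + 1)) ∧
      ∃ S₁ ∈ 𝒟, ∃ S₂ ∈ 𝒟, (∀ g ∈ K, g.right ∈ tsupport h → g ∈ arrowSet S₁) ∧
        ∀ g ∈ K, g.right ∈ tsupport (1 - h : C(X, ℝ)) → g ∈ arrowSet S₂ := by
  have := EtaleGroupoid.t2 (X := X)
  have := EtaleGroupoid.locallyCompact (X := X)
  have := EtaleGroupoid.normal_units (X := X)
  obtain ⟨L, hL, hKL⟩ := exists_compact_superset hK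
  -- the decomposition is applied to a neighbourhood of the products of up to `N + 1` elements of `L`
  obtain ⟨L', hL', hLL'⟩ := exists_compact_superset (isCompact_powers hL (N + 1))
  obtain ⟨U, hU, hcover, hgen⟩ := hdec (interior L') isOpen_interior
    ⟨L', hL', interior_subset, by simp [arrowSet_top]⟩
  have hcover : (U 1)ᶜ ⊆ U 0 := by
    intro x hx
    have : x ∈ U 0 ∪ U 1 := by
      rw [hcover]
      exact ⟨𝟙 x, trivial⟩
    exact this.resolve_right hx
  obtain ⟨S₁, hS₁, hgen₁⟩ := hgen 0
  obtain ⟨S₂, hS₂, hgen₂⟩ := hgen 1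
  obtain ⟨h₀, h₀01, h₀U, V, hV, hUV, h₀V⟩ := exists_bump (hU 1).isClosed_compl (hU 0) hcover
  let E := expand (interior L) (U 0)
  -- the `j`-th function is supported in the `j`-th expansion of `U 0`, which leaves room for the next
  have step : ∀ (j : ℕ) (f : C(X, ℝ)), tsupport f ⊆ E j → ∃ f' : C(X, ℝ),
      (∀ x, f' x ∈ Set.Icc (0 : ℝ) 1) ∧ tsupport f' ⊆ E (j + 1) ∧
        ∀ x ∈ tsupport f ∪ carry K (tsupport f), f' x = 1 := by
    intro j f hf
    obtain ⟨f', h1, h2, V, -, h3, h4⟩ := exists_bump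
      ((isClosed_tsupport f).union (isClosed_carry hK (isClosed_tsupport f)))
      (isOpen_expand isOpen_interior (hU 0) (j + 1) : IsOpen (E (j + 1)))
      (Set.union_subset_union hf (by
        rintro _ ⟨g, ⟨hg, hgf⟩, rfl⟩
        exact ⟨g, ⟨hKL hg, hf hgf⟩, rfl⟩))
    exact ⟨f', h1, h2, fun x hx => h4 x (h3 hx)⟩
  choose! next hnext using step
  let F : ℕ → C(X, ℝ) := fun n => Nat.rec h₀ (fun j f => next j f) n
  have hFE : ∀ n, tsupport (F n) ⊆ E n := fun n => by
    induction n with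
    | zero => exact h₀U
    | succ n ih => exact (hnext n _ ih).2.1
  have hF01 : ∀ n x, F n x ∈ Set.Icc (0 : ℝ) 1 := fun n => by
    cases n with
    | zero => exact h₀01
    | succ n => exact (hnext n _ (hFE n)).1
  have hF1 : ∀ n, ∀ x ∈ tsupport (F n) ∪ carry K (tsupport (F n)), F (n + 1) x = 1 :=
    fun n => (hnext n _ (hFE n)).2.2
  let h : C(X, ℝ) := ⟨fun x => (∑ j ∈ Finset.range (N + 1), F j x) / (N + 1), by fun_prop⟩
  have hsum : ∀ x, ∑ j ∈ Finset.range (N + 1), F j x ≤ N + 1 := fun x =>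
    (Finset.sum_le_sum fun j _ => (hF01 j x).2).trans (by simp)
  refine ⟨h, fun x => ⟨?_, ?_⟩, fun g hg => ?_, S₁, hS₁, S₂, hS₂, fun g hg hgh => ?_,
    fun g hg hgh => ?_⟩
  · exact div_nonneg (Finset.sum_nonneg fun j _ => (hF01 j x).1) (by positivity)
  · exact (div_le_one (by positivity)).2 (hsum x)
  · refine abs_average_sub_le hinv (fun j x => F j x) hF01 (fun j k hk hne => ?_) N hg
    exact hF1 j _ (Or.inr ⟨k, ⟨hk, subset_tsupport _ hne⟩, rfl⟩)
  · have hsupp : tsupport h ⊆ ⋃ j ∈ Finset.range (N + 1), tsupport (F j) := by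
      refine closure_minimal (fun x hx => ?_)
        ((Finset.range (N + 1)).finite_toSet.isClosed_biUnion fun j _ => isClosed_tsupport _)
      by_contra hne
      apply hx
      change (∑ j ∈ Finset.range (N + 1), F j x) / (N + 1) = 0
      rw [Finset.sum_eq_zero, zero_div]
      intro j hj
      by_contra hj'
      exact hne (Set.mem_biUnion hj (subset_tsupport _ hj'))
    obtain ⟨j, hj, hx⟩ := Set.mem_iUnion₂.1 (hsupp hgh)
    rw [← groupoidInv_groupoidInv g]
    refine groupoidInv_mem_arrowSet (mem_arrowSet_of_mem_expand interior_subset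
      ((powers_mono L ?_).trans hLL') hgen₁ (interior_subset (hKL (hinv g hg))) (hFE j hx))
    have := Finset.mem_range.1 hj
    omega
  -- where the first function is `1`, so are all the others
  · have hsupp : tsupport (1 - h : C(X, ℝ)) ⊆ Vᶜ := by
      refine closure_minimal (fun x hx hxV => hx ?_) hV.isClosed_compl
      have hone : ∀ n, F n x = 1 := fun n => by
        induction n with
        | zero => exact h₀V x hxV
        | succ n ih => exact hF1 n x (Or.inl (subset_tsupport _ (by simp [ih])))
      change 1 - (∑ j ∈ Finset.range (N + 1), F j x) / (N + 1) = 0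
      rw [Finset.sum_congr rfl fun j _ => hone j]
      simp
      field_simp
      simp
    have hgU : g.right ∈ U 1 := by
      by_contra hne
      exact hsupp hgh (hUV hne)
    rw [← groupoidInv_groupoidInv g]
    refine groupoidInv_mem_arrowSet (arrowSet_mono hgen₂ (subset_arrowSet_generatedBy _
      ⟨hLL' (powers_mono L (by omega : 1 ≤ N + 1) ?_), hgU⟩))
    exact Or.inr (Or.inl (interior_subset (hKL (hinv g hg))))

end AlmostInvariant

section ApproximateIdealStructure

/-! ### The approximate ideal structure -/

variable {X : Type u} [Groupoid.{v} X] [TopologicalSpace X] [TopologicalSpace (Arrow X)]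
  [EtaleGroupoid X]

theorem infDist_lt_of_map_mem {A : Type*} [NonUnitalCStarAlgebra A] {C : Set A} {a b : A} {δ : ℝ}
    {Φ : A →L[ℂ] A} (hΦ : ‖Φ (a - b)‖ < δ) (hb : Φ b ∈ C) : Metric.infDist (Φ a) C < δ := by
  refine (Metric.infDist_le_dist_of_mem hb).trans_lt ?_
  rwa [dist_eq_norm, ← map_sub]

/-- It suffices to verify the conditions of an approximate ideal structure, up to a factor, for
nearby elements. -/
theorem approximateIdeal_conditions_of_norm_sub_lt {A : Type*} [NonUnitalCStarAlgebra A]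
    {h : DoubleCentralizer ℂ A} (hh : ‖h‖ ≤ 1) {C D : NonUnitalStarSubalgebra ℂ A} {a b : A} {δ : ℝ}
    (hab : ‖a - b‖ < δ / 4) (hcomm : ‖h.fst b - h.snd b‖ < δ / 2) (hC : h.fst b ∈ C)
    (hD : (1 - h).fst b ∈ D) (hCD : (1 - h).fst (h.fst b) ∈ C ⊓ D)
    (hCD' : (1 - h).fst (h.fst (h.fst b)) ∈ C ⊓ D) :
    ‖h.fst a - h.snd a‖ < δ ∧
      Metric.infDist (h.fst a) (C : Set A) < δ ∧
      Metric.infDist ((1 - h).fst a) (D : Set A) < δ ∧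
      Metric.infDist (((1 - h) * h).fst a) ((C ⊓ D : NonUnitalStarSubalgebra ℂ A) : Set A) < δ ∧
      Metric.infDist (((1 - h) * h ^ 2).fst a)
        ((C ⊓ D : NonUnitalStarSubalgebra ℂ A) : Set A) < δ := by
  have hn1 : ∀ c, ‖h.fst c‖ ≤ ‖c‖ := fun c => by
    have := h.fst.le_of_opNorm_le (DoubleCentralizer.norm_fst h ▸ hh) c
    rwa [one_mul] at this
  have hn1' : ∀ c, ‖h.snd c‖ ≤ ‖c‖ := fun c => by
    have := h.snd.le_of_opNorm_le (DoubleCentralizer.norm_snd h ▸ hh) c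
    rwa [one_mul] at this
  have hn2 : ∀ c, ‖(1 - h).fst c‖ ≤ 2 * ‖c‖ := fun c => by
    rw [DoubleCentralizer.sub_fst, DoubleCentralizer.one_fst, sub_apply,
      one_apply_eq_self]
    linarith [norm_sub_le c (h.fst c), hn1 c]
  refine ⟨?_, ?_, ?_, ?_, ?_⟩
  · have h3 : h.fst a - h.snd a = h.fst (a - b) - h.snd (a - b) + (h.fst b - h.snd b) := by
      rw [map_sub, map_sub]; abel
    rw [h3]
    refine (norm_add_le _ _).trans_lt ?_
    linarith [norm_sub_le (h.fst (a - b)) (h.snd (a - b)), hn1 (a - b), hn1' (a - b)]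
  · exact infDist_lt_of_map_mem (b := b) (by linarith [hn1 (a - b), norm_nonneg (a - b)]) hC
  · exact infDist_lt_of_map_mem (b := b) (by linarith [hn2 (a - b), norm_nonneg (a - b)]) hD
  · refine infDist_lt_of_map_mem (b := b) ?_ ?_ <;>
      rw [DoubleCentralizer.mul_fst, mul_apply_eq_comp]
    · linarith [hn2 (h.fst (a - b)), hn1 (a - b), norm_nonneg (a - b)]
    · exact hCD
  · refine infDist_lt_of_map_mem (b := b) ?_ ?_ <;>
      rw [DoubleCentralizer.mul_fst, mul_apply_eq_comp, pow_two, DoubleCentralizer.mul_fst,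
        mul_apply_eq_comp]
    · linarith [hn2 (h.fst (h.fst (a - b))), hn1 (h.fst (a - b)), hn1 (a - b),
        norm_nonneg (a - b)]
    · exact hCD'

theorem leftConvolution_weighted_sub (f f' : C(Arrow X, ℂ)) (a : C_c(Arrow X, ℂ)) :
    leftConvolution (weighted (f - f') a) =
      leftConvolution (weighted f a) - leftConvolution (weighted f' a) := by
  refine entry_injective fun g k => ?_
  rw [entry_sub, entry_leftConvolution, entry_leftConvolution, entry_leftConvolution]
  simp only [convolutionKernel]
  split_ifs
  · simp [sub_mul]
  · simp

theorem leftConvolution_weighted_rangeWeight_one_sub (f : C(X, ℝ)) (a : C_c(Arrow X, ℂ)) :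
    leftConvolution (weighted (rangeWeight (1 - f)) a) =
      leftConvolution a - leftConvolution (weighted (rangeWeight f) a) := by
  refine entry_injective fun g k => ?_
  rw [entry_sub, entry_leftConvolution, entry_leftConvolution, entry_leftConvolution]
  simp only [convolutionKernel]
  split_ifs
  · simp [rangeWeight, sub_mul]
  · simp

set_option maxHeartbeats 1000000 in
theorem admitsApproximateIdealStructure [SecondCountableTopology (Arrow X)]
    {𝒟 : Set (Subgroupoid X)} (hdec : Decomposable (⊤ : Subgroupoid X) 𝒟) :
    AdmitsApproximateIdealStructure (reducedCStarAlgebra X) (algebraPairs 𝒟) := by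
  intro δ hδ F
  have happrox : ∀ a : reducedCStarAlgebra X, ∃ b : C_c(Arrow X, ℂ), ‖a - toReduced b‖ < δ / 4 :=
    fun a => by
      obtain ⟨b, hb⟩ := denseRange_toReduced.exists_dist_lt a (by positivity : (0 : ℝ) < δ / 4)
      exact ⟨b, by rwa [← dist_eq_norm]⟩
  choose b hb using happrox
  have hbound := fun a => exists_norm_weighted_le (b a)
  choose C hC0 hC using hbound
  let K₀ : Set (Arrow X) := ⋃ a ∈ F, tsupport (b a)
  have hK₀ : IsCompact K₀ := F.isCompact_biUnion fun a _ => (b a).hasCompactSupport.isCompact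
  -- `h` varies by at most `1 / (N + 1)` along the supports, so the commutators are less than `δ / 2`
  obtain ⟨N, hN⟩ := exists_nat_gt ((∑ a ∈ F, C a) / (δ / 2))
  obtain ⟨f, hf01, hfinv, S₁, hS₁, S₂, hS₂, h₁, h₂⟩ := exists_almost_invariant hdec
    (hK₀.union hK₀.image_groupoidInv) (by
      rintro g (hg | ⟨k, hk, rfl⟩)
      · exact Or.inr ⟨g, hg, rfl⟩
      · rw [groupoidInv_groupoidInv]; exact Or.inl hk) N
  have hf : ∀ x, |f x| ≤ 1 := fun x => abs_le.2 ⟨by linarith [(hf01 x).1], (hf01 x).2⟩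
  have hf' : ∀ x, |(1 - f) x| ≤ 1 := fun x =>
    abs_le.2 ⟨by change -1 ≤ 1 - f x; linarith [(hf01 x).2],
      by change 1 - f x ≤ 1; linarith [(hf01 x).1]⟩
  obtain ⟨h, hpos, hfst, hsnd⟩ := exists_isPositiveContraction f (fun x => (hf01 x).1)
    fun x => (hf01 x).2
  refine ⟨h, hpos, (subgroupoidAlgebra S₁, subgroupoidAlgebra S₂), ⟨S₁, hS₁, S₂, hS₂, rfl⟩,
    fun a ha => ?_⟩
  have hfstc : ∀ c, h.fst (toReduced c) = toReduced (weighted (rangeWeight f) c) := fun c =>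
    Subtype.ext ((hfst _).trans (unitDiagonal_mul_leftConvolution hf c))
  have hsndc : ∀ c, h.snd (toReduced c) = toReduced (weighted (sourceWeight f) c) := fun c =>
    Subtype.ext ((hsnd _).trans (leftConvolution_mul_unitDiagonal hf c))
  have hfstc' : ∀ c, (1 - h).fst (toReduced c) = toReduced (weighted (rangeWeight (1 - f)) c) := by
    intro c
    rw [DoubleCentralizer.sub_fst, DoubleCentralizer.one_fst, sub_apply, hfstc,
      one_apply_eq_self]
    exact Subtype.ext (leftConvolution_weighted_rangeWeight_one_sub f c).symm
  have hK : tsupport (b a) ⊆ K₀ := Set.subset_biUnion_of_mem (u := fun a => tsupport (b a)) ha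
  have hmem₁ : ∀ c : C_c(Arrow X, ℂ), tsupport c ⊆ tsupport (b a) →
      tsupport (weighted (rangeWeight f) c) ⊆ arrowSet S₁ := fun c hc g hg =>
    h₁ g (Or.inl (hK (hc (tsupport_weighted_subset _ _ hg))))
      (tsupport_rangeWeight_subset _ (tsupport_weighted_subset_left _ _ hg))
  have hmem₂ : ∀ c : C_c(Arrow X, ℂ), tsupport c ⊆ tsupport (b a) →
      tsupport (weighted (rangeWeight (1 - f)) c) ⊆ arrowSet S₂ := fun c hc g hg =>
    h₂ g (Or.inl (hK (hc (tsupport_weighted_subset _ _ hg))))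
      (tsupport_rangeWeight_subset _ (tsupport_weighted_subset_left _ _ hg))
  have ht : ∀ c : C_c(Arrow X, ℂ), tsupport c ⊆ tsupport (b a) →
      tsupport (weighted (rangeWeight f) c) ⊆ tsupport (b a) := fun c hc =>
    (tsupport_weighted_subset _ _).trans hc
  refine approximateIdeal_conditions_of_norm_sub_lt hpos.2 (hb a) ?_ ?_ ?_ ?_ ?_
  · have heq : ((h.fst (toReduced (b a)) - h.snd (toReduced (b a)) : reducedCStarAlgebra X) :
        groupoidL2 X →L[ℂ] groupoidL2 X) =
        leftConvolution (weighted (rangeWeight f - sourceWeight f) (b a)) := by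
      rw [hfstc, hsndc]
      exact (leftConvolution_weighted_sub _ _ _).symm
    change ‖((h.fst (toReduced (b a)) - h.snd (toReduced (b a)) : reducedCStarAlgebra X) :
        groupoidL2 X →L[ℂ] groupoidL2 X)‖ < _
    rw [heq]
    refine (hC a _ (1 / (N + 1)) (by positivity) fun g hg => ?_).trans_lt ?_
    · change ‖(f g.right : ℂ) - (f g.left : ℂ)‖ ≤ _
      rw [← Complex.ofReal_sub, Complex.norm_real]
      exact hfinv g (Or.inl (hK hg))
    · rw [mul_one_div, div_lt_iff₀ (by positivity)]
      rw [div_lt_iff₀ (by positivity)] at hN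
      have := Finset.single_le_sum (fun a _ => hC0 a) ha
      linarith
  · rw [hfstc]
    exact toReduced_mem_subgroupoidAlgebra (hmem₁ _ subset_rfl)
  · rw [hfstc']
    exact toReduced_mem_subgroupoidAlgebra (hmem₂ _ subset_rfl)
  · rw [hfstc, hfstc']
    exact ⟨toReduced_mem_subgroupoidAlgebra
      ((tsupport_weighted_subset _ _).trans (hmem₁ _ subset_rfl)),
      toReduced_mem_subgroupoidAlgebra (hmem₂ _ (ht _ subset_rfl))⟩
  · rw [hfstc, hfstc, hfstc']
    exact ⟨toReduced_mem_subgroupoidAlgebra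
      ((tsupport_weighted_subset _ _).trans (hmem₁ _ (ht _ subset_rfl))),
      toReduced_mem_subgroupoidAlgebra (hmem₂ _ (ht _ (ht _ subset_rfl)))⟩

end ApproximateIdealStructure

section DiagonalBlocks

/-! ### Compression to blocks of coordinates -/

variable {ι κ : Type*} {A : κ → Set ι}

theorem norm_indicator_one_le (s : Set ι) (i : ι) : ‖s.indicator (1 : ι → ℂ) i‖ ≤ 1 := by
  by_cases h : i ∈ s <;> simp [h]

theorem isOrthogonalProjectionFamily_diagonal (hA : Pairwise (Function.onFun Disjoint A)) :
    IsOrthogonalProjectionFamily fun c => diagonal ((A c).indicator (1 : ι → ℂ)) where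
  symm c x y := by
    have h : star (diagonal ((A c).indicator (1 : ι → ℂ))) = diagonal ((A c).indicator 1) :=
      star_diagonal (norm_indicator_one_le _) fun i => by by_cases h : i ∈ A c <;> simp [h]
    rw [ContinuousLinearMap.star_eq_adjoint] at h
    rw [← ContinuousLinearMap.adjoint_inner_right, h]
  idem c x := by
    ext i
    rw [diagonal_apply (norm_indicator_one_le _), diagonal_apply (norm_indicator_one_le _)]
    by_cases h : i ∈ A c <;> simp [h]
  orthogonal c d hcd x := by
    ext i
    rw [diagonal_apply (norm_indicator_one_le _), diagonal_apply (norm_indicator_one_le _)]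
    by_cases h : i ∈ A c
    · have h' : i ∉ A d := Set.disjoint_left.1 (hA hcd) h
      simp [h']
    · simp [h]

open scoped Classical in
/-- Compression to disjoint blocks keeps the entries inside the blocks and deletes the others. -/
theorem entry_compression_diagonal (hA : Pairwise (Function.onFun Disjoint A))
    (T : EllTwo ι →L[ℂ] EllTwo ι) (i j : ι) :
    entry ((isOrthogonalProjectionFamily_diagonal hA).compression T) i j =
      if ∃ c, i ∈ A c ∧ j ∈ A c then entry T i j else 0 := by
  have h := ((isOrthogonalProjectionFamily_diagonal hA).hasSum_compression T
    (lp.single 2 j (1 : ℂ))).mapL (coordinate i)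
  have h' : HasSum (fun c => (A c).indicator (1 : ι → ℂ) i *
      (entry T i j * (A c).indicator (1 : ι → ℂ) j))
      (entry ((isOrthogonalProjectionFamily_diagonal hA).compression T) i j) := by
    refine h.congr_fun fun c => ?_
    rw [← entry_mul_diagonal (norm_indicator_one_le _),
      ← entry_diagonal_mul (norm_indicator_one_le _)]
    rfl
  refine h'.unique ?_
  split_ifs with hc
  · obtain ⟨c, hi, hj⟩ := hc
    convert hasSum_single c fun d hd => ?_ using 1
    · simp [hi, hj]
    · have : i ∉ A d := Set.disjoint_left.1 (hA hd.symm) hi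
      simp [this]
  · convert hasSum_zero with c
    by_cases hi : i ∈ A c
    · have : j ∉ A c := fun hj => hc ⟨c, hi, hj⟩
      simp [this]
    · simp [hi]

end DiagonalBlocks

section Expectation

/-! ### The conditional expectation onto the algebra of a clopen subgroupoid -/

variable {X : Type u} [Groupoid.{v} X]

/-- The coset `S k`: the elements `g` such that `g k⁻¹` is defined and lies in `S`. It contains `k` if
the range of `k` is a unit of `S`, and is empty otherwise. -/
def coset (S : Subgroupoid X) (k : Arrow X) : Set (Arrow X) :=
  {g | ∃ e : g.left = k.left, groupoidMul g (groupoidInv k) e ∈ arrowSet S}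

theorem mem_coset_symm {S : Subgroupoid X} {g k : Arrow X} (h : g ∈ coset S k) : k ∈ coset S g := by
  obtain ⟨e, h⟩ := h
  refine ⟨e.symm, ?_⟩
  convert groupoidInv_mem_arrowSet h
  refine Eq.symm ((groupoidInv_groupoidMul (h := groupoidInv k) e).trans ?_)
  congr 1
  exact groupoidInv_groupoidInv k

theorem mem_coset_trans {S : Subgroupoid X} {g j k : Arrow X} (h : g ∈ coset S j)
    (h' : j ∈ coset S k) : g ∈ coset S k := by
  obtain ⟨e, h⟩ := h
  obtain ⟨e', h'⟩ := h'
  refine ⟨e.trans e', ?_⟩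
  rw [← groupoidMul_div_div e e']
  exact groupoidMul_mem_arrowSet h h' rfl

theorem coset_eq_of_mem {S : Subgroupoid X} {g k : Arrow X} (h : g ∈ coset S k) :
    coset S g = coset S k :=
  Set.ext fun _ => ⟨fun h' => mem_coset_trans h' h, fun h' => mem_coset_trans h' (mem_coset_symm h)⟩

/-- The block of a set `c` of groupoid elements: it is `c` if `c` is a coset `S k`, and
empty otherwise. -/
def cosetBlock (S : Subgroupoid X) (c : Set (Arrow X)) : Set (Arrow X) :=
  {g | coset S g = c ∧ g ∈ c}

theorem pairwise_disjoint_cosetBlock (S : Subgroupoid X) :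
    Pairwise (Function.onFun Disjoint (cosetBlock S)) := fun _ _ h =>
  Set.disjoint_left.2 fun _ hg hg' => h (hg.1.symm.trans hg'.1)

theorem exists_mem_cosetBlock_iff {S : Subgroupoid X} {g k : Arrow X} :
    (∃ c, g ∈ cosetBlock S c ∧ k ∈ cosetBlock S c) ↔ g ∈ coset S k := by
  constructor
  · rintro ⟨c, ⟨-, hg⟩, ⟨rfl, -⟩⟩
    exact hg
  · intro h
    have h' := mem_coset_symm h
    exact ⟨coset S k, ⟨coset_eq_of_mem h, h⟩, rfl, mem_coset_trans h' h⟩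

theorem mem_cosetBlock_iff_of_mem_coset {S : Subgroupoid X} {g k : Arrow X} (h : g ∈ coset S k)
    (c : Set (Arrow X)) : g ∈ cosetBlock S c ↔ k ∈ cosetBlock S c := by
  have key : ∀ {g k : Arrow X}, g ∈ coset S k → g ∈ cosetBlock S c → k ∈ cosetBlock S c := by
    rintro g k h ⟨rfl, -⟩
    exact ⟨(coset_eq_of_mem h).symm, mem_coset_symm h⟩
  exact ⟨key h, key (mem_coset_symm h)⟩

/-- The projection of `ℓ²(G)` onto the functions supported in `c`, if `c` is a coset of `S`; zero
otherwise. -/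
noncomputable def cosetProjection (S : Subgroupoid X) (c : Set (Arrow X)) :
    groupoidL2 X →L[ℂ] groupoidL2 X :=
  diagonal ((cosetBlock S c).indicator 1)

theorem isOrthogonalProjectionFamily_cosetProjection (S : Subgroupoid X) :
    IsOrthogonalProjectionFamily (cosetProjection S) :=
  isOrthogonalProjectionFamily_diagonal (pairwise_disjoint_cosetBlock S)

/-- Compression of operators on `ℓ²(G)` to the blocks given by the cosets of `S`. -/
noncomputable def cosetCompression (S : Subgroupoid X) :
    (groupoidL2 X →L[ℂ] groupoidL2 X) →L[ℂ] (groupoidL2 X →L[ℂ] groupoidL2 X) :=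
  (isOrthogonalProjectionFamily_cosetProjection S).compression

variable [TopologicalSpace (Arrow X)]

/-- The indicator function of a clopen subgroupoid. -/
noncomputable def clopenIndicator {S : Subgroupoid X} (hS : IsClopen (arrowSet S)) :
    C(Arrow X, ℂ) :=
  ⟨(arrowSet S).indicator 1, continuous_one.indicator (by simp [hS.frontier_eq])⟩

theorem tsupport_weighted_clopenIndicator_subset {S : Subgroupoid X} (hS : IsClopen (arrowSet S))
    (a : C_c(Arrow X, ℂ)) : tsupport (weighted (clopenIndicator hS) a) ⊆ arrowSet S :=
  (tsupport_weighted_subset_left _ _).trans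
    (closure_minimal (fun g hg => by by_contra h; exact hg (by simp [clopenIndicator, h]))
      hS.isClosed)

variable [TopologicalSpace X] [EtaleGroupoid X]

theorem cosetCompression_leftConvolution (S : Subgroupoid X) {a b : C_c(Arrow X, ℂ)}
    (hb : ∀ g ∈ arrowSet S, b g = a g) (hb' : ∀ g ∉ arrowSet S, b g = 0) :
    cosetCompression S (leftConvolution a) = leftConvolution b := by
  classical
  refine entry_injective fun g k => ?_
  refine (entry_compression_diagonal (pairwise_disjoint_cosetBlock S) _ g k).trans ?_
  rw [exists_mem_cosetBlock_iff, entry_leftConvolution, entry_leftConvolution, convolutionKernel,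
    convolutionKernel]
  by_cases e : g.left = k.left
  · rw [dif_pos e, dif_pos e]
    by_cases h : groupoidMul g (groupoidInv k) e ∈ arrowSet S
    · rw [if_pos ⟨e, h⟩, hb _ h]
    · rw [if_neg (fun h' => h h'.2), hb' _ h]
  · rw [if_neg (fun h' => e h'.1), dif_neg e]

theorem cosetCompression_leftConvolution_eq_weighted {S : Subgroupoid X}
    (hS : IsClopen (arrowSet S)) (a : C_c(Arrow X, ℂ)) :
    cosetCompression S (leftConvolution a) = leftConvolution (weighted (clopenIndicator hS) a) :=
  cosetCompression_leftConvolution S (fun g hg => by simp [clopenIndicator, hg])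
    fun g hg => by simp [clopenIndicator, hg]

theorem cosetCompression_mem {S : Subgroupoid X} (hS : IsClopen (arrowSet S))
    (T : reducedCStarAlgebra X) :
    cosetCompression S (T : groupoidL2 X →L[ℂ] groupoidL2 X) ∈ reducedCStarAlgebra X := by
  refine denseRange_toReduced.induction_on T
    (isClosed_reducedCStarAlgebra.preimage (by fun_prop)) fun a => ?_
  change cosetCompression S (leftConvolution a) ∈ _
  rw [cosetCompression_leftConvolution_eq_weighted hS]
  exact (toReduced _).2

/-- The conditional expectation of `C*_r(G)` onto `C*_r(S)`, for a clopen subgroupoid `S`: it deletes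
the matrix entries outside the blocks given by the cosets of `S`. -/
noncomputable def expectation {S : Subgroupoid X} (hS : IsClopen (arrowSet S)) :
    reducedCStarAlgebra X →L[ℂ] reducedCStarAlgebra X :=
  LinearMap.mkContinuous
    { toFun := fun T => ⟨cosetCompression S T, cosetCompression_mem hS T⟩
      map_add' := fun T T' => Subtype.ext (map_add (cosetCompression S) T.1 T'.1)
      map_smul' := fun c T => Subtype.ext (map_smul (cosetCompression S) c T.1) } 1 fun T => by
        rw [one_mul]
        exact (isOrthogonalProjectionFamily_cosetProjection S).norm_compression_le T.1

theorem expectation_toReduced {S : Subgroupoid X} (hS : IsClopen (arrowSet S)) {a b : C_c(Arrow X, ℂ)}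
    (hb : ∀ g ∈ arrowSet S, b g = a g) (hb' : ∀ g ∉ arrowSet S, b g = 0) :
    expectation hS (toReduced a) = toReduced b :=
  Subtype.ext (cosetCompression_leftConvolution S hb hb')

theorem expectation_toReduced_eq_weighted {S : Subgroupoid X} (hS : IsClopen (arrowSet S))
    (a : C_c(Arrow X, ℂ)) :
    expectation hS (toReduced a) = toReduced (weighted (clopenIndicator hS) a) :=
  Subtype.ext (cosetCompression_leftConvolution_eq_weighted hS a)

theorem expectation_mem {S : Subgroupoid X} (hS : IsClopen (arrowSet S))
    (T : reducedCStarAlgebra X) : expectation hS T ∈ subgroupoidAlgebra S := by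
  refine denseRange_toReduced.induction_on T
    ((isClosed_subgroupoidAlgebra S).preimage (expectation hS).continuous) fun a => ?_
  rw [expectation_toReduced_eq_weighted]
  exact toReduced_mem_subgroupoidAlgebra (tsupport_weighted_clopenIndicator_subset hS a)

theorem expectation_eq_self {S : Subgroupoid X} (hS : IsClopen (arrowSet S))
    {T : reducedCStarAlgebra X} (hT : T ∈ subgroupoidAlgebra S) : expectation hS T = T := by
  refine closure_minimal ?_ (isClosed_eq (expectation hS).continuous continuous_id)
    (subgroupoidAlgebra_subset_closure S hT)
  rintro _ ⟨a, ha, rfl⟩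
  exact expectation_toReduced hS (fun _ _ => rfl)
    fun g hg => image_eq_zero_of_notMem_tsupport fun h => hg (ha h)

/-- The expectation onto `C*_r(S)` maps `C*_r(S')` to `C*_r(S) ∩ C*_r(S')`. -/
theorem expectation_mem_inf {S S' : Subgroupoid X} (hS : IsClopen (arrowSet S))
    {T : reducedCStarAlgebra X} (hT : T ∈ subgroupoidAlgebra S') :
    expectation hS T ∈ subgroupoidAlgebra S ⊓ subgroupoidAlgebra S' := by
  refine ⟨expectation_mem hS T, ?_⟩
  refine closure_minimal ?_ ((isClosed_subgroupoidAlgebra S').preimage (expectation hS).continuous)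
    (subgroupoidAlgebra_subset_closure S' hT)
  rintro _ ⟨a, ha, rfl⟩
  change expectation hS (toReduced a) ∈ subgroupoidAlgebra S'
  rw [expectation_toReduced_eq_weighted]
  exact toReduced_mem_subgroupoidAlgebra ((tsupport_weighted_subset _ _).trans ha)

/-- Elements of `C*_r(S)` are block diagonal. -/
theorem cosetProjection_commute {S : Subgroupoid X} {T : reducedCStarAlgebra X}
    (hT : T ∈ subgroupoidAlgebra S) (c : Set (Arrow X)) :
    cosetProjection S c * (T : groupoidL2 X →L[ℂ] groupoidL2 X) = T * cosetProjection S c := by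
  refine closure_minimal (t := {T : reducedCStarAlgebra X | cosetProjection S c *
    (T : groupoidL2 X →L[ℂ] groupoidL2 X) = T * cosetProjection S c}) ?_
    (isClosed_eq (by fun_prop) (by fun_prop)) (subgroupoidAlgebra_subset_closure S hT)
  rintro _ ⟨a, ha, rfl⟩
  refine entry_injective fun g k => ?_
  change entry (cosetProjection S c * leftConvolution a) g k =
    entry (leftConvolution a * cosetProjection S c) g k
  rw [cosetProjection, entry_diagonal_mul (norm_indicator_one_le _),
    entry_mul_diagonal (norm_indicator_one_le _), entry_leftConvolution]
  by_cases h : convolutionKernel a g k = 0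
  · rw [h, mul_zero, zero_mul]
  have hgk : g ∈ coset S k := by
    rw [convolutionKernel] at h
    split_ifs at h with e
    · exact ⟨e, ha (subset_tsupport _ h)⟩
    · exact absurd rfl h
  have hiff := mem_cosetBlock_iff_of_mem_coset hgk c
  by_cases hg : g ∈ cosetBlock S c
  · simp [hg, hiff.1 hg]
  · simp [hg, mt hiff.2 hg]

/-- A positive operator in a closed *-subalgebra has its square root there. -/
theorem exists_eq_star_mul_self_of_isPositive {H : Type*} [NormedAddCommGroup H]
    [InnerProductSpace ℂ H] [CompleteSpace H] {A : NonUnitalStarSubalgebra ℂ (H →L[ℂ] H)}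
    (hA : IsClosed (A : Set (H →L[ℂ] H))) {T : H →L[ℂ] H} (hT : T ∈ A) (hpos : T.IsPositive) :
    ∃ b ∈ A, T = star b * b := by
  have h0 : 0 ≤ T := ContinuousLinearMap.nonneg_iff_isPositive T |>.2 hpos
  refine ⟨CFC.sqrt T, ?_, ?_⟩
  · rw [CFC.sqrt_eq_real_sqrt T h0]
    exact cfcₙ_mem (hs := hA) Real.sqrt hT
  · rw [(IsSelfAdjoint.of_nonneg (CFC.sqrt_nonneg T)).star_eq, CFC.sqrt_mul_sqrt_self T h0]

theorem isConditionalExpectation_expectation {S : Subgroupoid X} (hS : IsClopen (arrowSet S)) :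
    IsConditionalExpectation (subgroupoidAlgebra S) (expectation hS) where
  mem := expectation_mem hS
  apply_of_mem _ hc := expectation_eq_self hS hc
  norm_apply_le T := (isOrthogonalProjectionFamily_cosetProjection S).norm_compression_le T.1
  positive T := by
    obtain ⟨b, hb, h⟩ := exists_eq_star_mul_self_of_isPositive isClosed_reducedCStarAlgebra
      (expectation hS (star T * T)).2
      ((isOrthogonalProjectionFamily_cosetProjection S).isPositive_compression_star_mul_self T.1)
    exact ⟨⟨b, hb⟩, Subtype.ext h⟩
  left c hc T := Subtype.ext ((isOrthogonalProjectionFamily_cosetProjection S).compression_mul_left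
    (cosetProjection_commute hc) T.1)
  right c hc T := Subtype.ext
    ((isOrthogonalProjectionFamily_cosetProjection S).compression_mul_right
      (cosetProjection_commute hc) T.1)

end Expectation

section Uniformity

/-! ### Uniformity of the approximate ideal structure -/

variable {A B H K : Type*} [NonUnitalCStarAlgebra A] [NonUnitalCStarAlgebra B]
  [NormedAddCommGroup H] [InnerProductSpace ℂ H] [CompleteSpace H]
  [NormedAddCommGroup K] [InnerProductSpace ℂ K] [CompleteSpace K]

/-- A bounded operator that acts on elementary tensors through a map `E : A → A` carries `C ⊗ B` into
`D ⊗ B` if `E` carries `C` into `D`. -/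
theorem map_mem_spatialTensor {π : A →⋆ₙₐ[ℂ] (H →L[ℂ] H)} {ρ : B →⋆ₙₐ[ℂ] (K →L[ℂ] K)}
    {Φ : (HilbertTensor H K →L[ℂ] HilbertTensor H K) →L[ℂ]
      (HilbertTensor H K →L[ℂ] HilbertTensor H K)} {E : A → A}
    {C D : NonUnitalStarSubalgebra ℂ A}
    (hΦ : ∀ a b, Φ (opTensor (π a) (ρ b)) = opTensor (π (E a)) (ρ b)) (hE : ∀ a ∈ C, E a ∈ D)
    {T : HilbertTensor H K →L[ℂ] HilbertTensor H K} (hT : T ∈ spatialTensor π ρ C) :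
    Φ T ∈ spatialTensor π ρ D := by
  have hle : Submodule.span ℂ {T | ∃ a ∈ C, ∃ b : B, T = opTensor (π a) (ρ b)} ≤
      (spatialTensor π ρ D).comap Φ.toLinearMap := by
    rw [Submodule.span_le]
    rintro _ ⟨a, ha, b, rfl⟩
    refine Submodule.le_topologicalClosure _ (Submodule.subset_span ⟨E a, hE a ha, b, ?_⟩)
    exact hΦ a b
  exact Submodule.topologicalClosure_minimal _ hle
    ((Submodule.isClosed_topologicalClosure _).preimage Φ.continuous) hT

theorem map_eq_self_of_mem_spatialTensor {π : A →⋆ₙₐ[ℂ] (H →L[ℂ] H)}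
    {ρ : B →⋆ₙₐ[ℂ] (K →L[ℂ] K)}
    {Φ : (HilbertTensor H K →L[ℂ] HilbertTensor H K) →L[ℂ]
      (HilbertTensor H K →L[ℂ] HilbertTensor H K)} {E : A → A}
    {C : NonUnitalStarSubalgebra ℂ A}
    (hΦ : ∀ a b, Φ (opTensor (π a) (ρ b)) = opTensor (π (E a)) (ρ b)) (hE : ∀ a ∈ C, E a = a)
    {T : HilbertTensor H K →L[ℂ] HilbertTensor H K} (hT : T ∈ spatialTensor π ρ C) : Φ T = T := by
  have hle : Submodule.span ℂ {T | ∃ a ∈ C, ∃ b : B, T = opTensor (π a) (ρ b)} ≤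
      LinearMap.eqLocus Φ.toLinearMap LinearMap.id := by
    rw [Submodule.span_le]
    rintro _ ⟨a, ha, b, rfl⟩
    exact (hΦ a b).trans (by rw [hE a ha]; rfl)
  exact Submodule.topologicalClosure_minimal _ hle
    (isClosed_eq Φ.continuous continuous_id) hT

variable {X : Type u} [Groupoid.{v} X] [TopologicalSpace X] [TopologicalSpace (Arrow X)]
  [EtaleGroupoid X]

/-- The expectation `E` onto `C*_r(S₁)`, tensored with the identity of `B`, is a contraction that
fixes `c` and carries `d` into the intersection, so `(E ⊗ id) d` is as close to `c` as `d` is. -/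
theorem exists_mem_spatialTensor_inf {S₁ S₂ : Subgroupoid X} (hS₁ : IsClopen (arrowSet S₁))
    {ρ : B →⋆ₙₐ[ℂ] (K →L[ℂ] K)}
    {c d : HilbertTensor (groupoidL2 X) K →L[ℂ] HilbertTensor (groupoidL2 X) K}
    (hc : c ∈ spatialTensor (NonUnitalStarSubalgebraClass.subtype (reducedCStarAlgebra X)) ρ
      (subgroupoidAlgebra S₁))
    (hd : d ∈ spatialTensor (NonUnitalStarSubalgebraClass.subtype (reducedCStarAlgebra X)) ρ
      (subgroupoidAlgebra S₂)) :
    ∃ x ∈ spatialTensor (NonUnitalStarSubalgebraClass.subtype (reducedCStarAlgebra X)) ρ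
      (subgroupoidAlgebra S₁ ⊓ subgroupoidAlgebra S₂), ‖x - c‖ ≤ ‖c - d‖ := by
  have hP := (isOrthogonalProjectionFamily_cosetProjection S₁).opTensor_one (K := K)
  have hΦ : ∀ (a : reducedCStarAlgebra X) (b : B), hP.compression
      (opTensor (NonUnitalStarSubalgebraClass.subtype (reducedCStarAlgebra X) a) (ρ b)) =
      opTensor (NonUnitalStarSubalgebraClass.subtype (reducedCStarAlgebra X)
        (expectation hS₁ a)) (ρ b) := fun a b =>
    (isOrthogonalProjectionFamily_cosetProjection S₁).compression_opTensor _ _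
  refine ⟨hP.compression d,
    map_mem_spatialTensor hΦ (fun a ha => expectation_mem_inf hS₁ ha) hd, ?_⟩
  calc ‖hP.compression d - c‖ = ‖hP.compression (c - d)‖ := by
        rw [map_sub, map_eq_self_of_mem_spatialTensor hΦ (fun a ha => expectation_eq_self hS₁ ha) hc,
          norm_sub_rev]
    _ ≤ ‖c - d‖ := hP.norm_compression_le _

end Uniformity

theorem mainTheorem3 {X : Type u} [Groupoid.{v} X] [TopologicalSpace X] [TopologicalSpace (Arrow X)]
    [EtaleGroupoid X] [SecondCountableTopology (Arrow X)]
    (𝒟 : Set (Subgroupoid X)) (hopen : ∀ S ∈ 𝒟, IsOpen (arrowSet S))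
    (hdec : Decomposable (⊤ : Subgroupoid X) 𝒟) :
    AdmitsApproximateIdealStructure (reducedCStarAlgebra X) (algebraPairs 𝒟) ∧
    ((∀ S ∈ 𝒟, IsClosed (arrowSet S)) →
      AdmitsUniformApproximateIdealStructure.{w}
        (NonUnitalStarSubalgebraClass.subtype (reducedCStarAlgebra X)) (algebraPairs 𝒟) ∧
      ∀ S ∈ 𝒟, ∃ E : reducedCStarAlgebra X →L[ℂ] reducedCStarAlgebra X,
        IsConditionalExpectation (subgroupoidAlgebra S) E ∧
        ∀ a b : C_c(Arrow X, ℂ), (∀ g ∈ arrowSet S, b g = a g) → (∀ g ∉ arrowSet S, b g = 0) →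
          E (toReduced a) = toReduced b) := by
  have h := admitsApproximateIdealStructure hdec
  refine ⟨h, fun hclosed => ⟨⟨Subtype.val_injective, h, fun ε hε => ?_⟩, fun S hS => ?_⟩⟩
  · refine ⟨ε / 2, by positivity, ?_⟩
    rintro _ ⟨S₁, hS₁, S₂, hS₂, rfl⟩ B _ K _ _ _ ρ - c hc d hd hcd
    obtain ⟨x, hx, hxc⟩ :=
      exists_mem_spatialTensor_inf ⟨hclosed S₁ hS₁, hopen S₁ hS₁⟩ hc hd
    refine ⟨x, hx, by linarith, ?_⟩
    have := norm_add_le (x - c) (c - d)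
    rw [sub_add_sub_cancel] at this
    linarith
  · exact ⟨expectation ⟨hclosed S hS, hopen S hS⟩, isConditionalExpectation_expectation _,
      fun a b hb hb' => expectation_toReduced _ hb hb'⟩
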